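/- Let $a_1,a_2,\dots$ be independent random variables with values in $(0,1)$ and common distribution function $G(x)=\mathbb P(a_i\le x)$, $x\in[0,1]$. Assume that, for some $\epsilon\in(0,1)$, $G$ is continuously differentiable on $(1-\epsilon,1)$ with derivative satisfying $$g(x)=\kappa\beta(1-x)^{\beta-1}\bigl(1+O((1-x)^{\nu})\bigr),\qquad x\to1-,$$ for some $\beta>1$, $\nu>0$, $\kappa>0$. For each $N\ge1$ let $\widehat\rho_{i}=\widehat\rho_{i,N}$, $1\le i\le N$, be arbitrary random variables on the same probability space (no assumption is made on their dependence on one another or on the $a_i$), and put $\widehat a_i=a_i+\widehat\rho_i$. Fix $r>1$, let $\delta=\delta_N>0$, and define $$\widetilde a_i=\min\{\widehat a_i,\,1-\delta^{r}\},\qquad \widetilde\beta_N=\frac{\sum_{i=1}^N\mathbf 1(\widetilde a_i>1-\delta)}{\sum_{i=1}^N\mathbf 1(\widetilde a_i>1-\delta)\,\ln\bigl(\delta/(1-\widetilde a_i)\bigr)},$$ where $\widetilde\beta_N:=0$ if the denominator vanishes. Suppose that, as $N\to\infty$, $\delta\to0$, $$N\delta^{\beta}\to\infty\qquad\text{and}\qquad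 N\delta^{\beta+2\min\{\nu,(r-1)\beta\}}\to0 .$$ Suppose moreover that for some $p\ge1$ and some real sequences $\chi=\chi_N\to0$, $\chi'=\chi'_N\to0$, $$\max_{1\le i\le N}\mathbb P(|\widehat\rho_i|>\varepsilon)\le\frac{\chi}{\varepsilon^{p}}+\chi'\qquad\text{for all }\varepsilon\in(0,1)\text{ and all }N\ge1,$$ and $$\sqrt{N\delta^{\beta}}\;\max\Bigl\{\frac{\chi'}{\delta^{\beta}},\Bigl(\frac{\chi}{\delta^{p+\beta}}\Bigr)^{1/(p+1)}\Bigr\}\ln\delta\to0 .$$ Then $$\sqrt{N\delta^{\beta}}\,(\widetilde\beta_N-\beta)\ \to_d\ \mathcal N(0,\beta^2/\kappa)\qquad(N\to\infty).$$ -/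

import Mathlib

open MeasureTheory ProbabilityTheory Filter Topology Asymptotics

noncomputable section

/-- Assumption (G): `a 0, a 1, …` are independent random variables with values in `(0,1)` and common
distribution function `G` on `[0,1]`, and `G` is continuously differentiable on some `(1 - ε, 1)`,
with derivative `g x = κ β (1 - x)^(β - 1) (1 + O((1 - x)^ν))` as `x → 1-`. -/
structure AssumptionG {Ω : Type*} [MeasurableSpace Ω] (P : Measure Ω) (a : ℕ → Ω → ℝ)
    (G : ℝ → ℝ) (β ν κ : ℝ) : Prop where
  one_lt_beta : 1 < β
  nu_pos : 0 < ν
  kappa_pos : 0 < κ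
  measurable : ∀ i, Measurable (a i)
  mem_Ioo : ∀ i, ∀ᵐ ω ∂P, a i ω ∈ Set.Ioo (0 : ℝ) 1
  indep : iIndepFun a P
  cdf_eq : ∀ i, ∀ x ∈ Set.Icc (0 : ℝ) 1, P.real {ω | a i ω ≤ x} = G x
  density : ∃ ε ∈ Set.Ioo (0 : ℝ) 1, ∃ g R : ℝ → ℝ,
    ContinuousOn g (Set.Ioo (1 - ε) 1) ∧
    (∀ x ∈ Set.Ioo (1 - ε) 1, HasDerivAt G (g x) x) ∧
    (∀ x ∈ Set.Ioo (1 - ε) 1, g x = κ * β * (1 - x) ^ (β - 1) * (1 + R x)) ∧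
    R =O[𝓝[<] (1 : ℝ)] fun x => (1 - x) ^ ν

/-- The Goldie–Smith estimator with threshold `δ`, evaluated at the sample `x 0, …, x (N - 1)`. -/
def goldieSmith (N : ℕ) (δ : ℝ) (x : ℕ → ℝ) : ℝ :=
  (∑ i ∈ Finset.range N, if 1 - δ < x i then (1 : ℝ) else 0) /
    ∑ i ∈ Finset.range N, if 1 - δ < x i then Real.log (δ / (1 - x i)) else 0

/-- The noisy estimator: the Goldie–Smith estimator with threshold `δ` evaluated at the observations
`y 0, …, y (N - 1)` truncated at the level `1 - δ ^ r`. -/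
def noisyTailEstimator (N : ℕ) (δ r : ℝ) (y : ℕ → ℝ) : ℝ :=
  goldieSmith N δ fun i => min (y i) (1 - δ ^ r)

end

/-!
For a level `v` write `T v = P(a > 1 - v) = 1 - G (1 - v)`. Let `ℓ i` be the logarithmic excess
`log (δ / (1 - ã i))` of an observation above `1 - δ`, and `0` otherwise; truncation makes it take
values in `[0, L]` with `L = (r - 1) |log δ|`. With `M = N δ ^ β` the estimator satisfies
`√M (β̃ - β) = S / D`, where `S = M ^ (-1/2) ∑ (1(0 < ℓ i) - β ℓ i)` and `D = M⁻¹ ∑ ℓ i`, as long as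
`D ≠ 0`.

*Noiseless sample.* Integrating the density gives `T u = κ u ^ β + O(u ^ (β + ν))`
(`AssumptionG.exists_tail_bounds`), and `{t < ℓ i} = {a i > 1 - δ e ^ (-t)}` for `0 ≤ t < L`. So the
tail of `ℓ i` is that of a variable which is exponential of rate `β` with probability `κ δ ^ β` and
zero otherwise, up to errors. A layer-cake formula expresses the characteristic function of
`c₀ 1(0 < ℓ) + c₁ ℓ` linearly in this tail, so its distance to the exponential case is explicit
(`norm_charFun_jumpAffine_sub_le`). As a summand differs from `0` with probability of order `δ ^ β`
only, taking `N`-th powers and using Lévy's continuity theorem gives `S → 𝒩(0, κ)` in distribution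
and `D → κ / β` in probability; the bias has order `√M (δ ^ ν + δ ^ ((r - 1) β)) → 0`. No moments are
computed.

*Noise.* The excess is `∫₀ᴸ 1(y > 1 - δ e ^ (-t)) dt`, so the `L¹` effect of the noise on it is at
most `L` times a bound on the probability that the noise moves an observation across a given level
`1 - v`, `v ≤ δ` (`integral_abs_sub_le`). Crossing requires either `|ρ| > η δ` or an observation
within `η δ` of the level, which has probability `O(η δ ^ β)` because `T` has slope `O(δ ^ (β - 1))`
on `[0, 3 δ]` (`AssumptionG.exists_crossing_bound`). Taking `η` to be the maximum in the rate condition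
balances the two (`exists_noise_scale`), and summing over `i` requires no independence. Slutsky's
theorem then gives the limit of `S / D`.
-/

/-! ### Tail of the distribution function near the endpoint -/

namespace AssumptionG

variable {Ω : Type*} [MeasurableSpace Ω] {P : Measure Ω} {a : ℕ → Ω → ℝ} {G : ℝ → ℝ} {β ν κ : ℝ}

lemma apply_one [IsProbabilityMeasure P] (h : AssumptionG P a G β ν κ) : G 1 = 1 := by
  have : P.real {ω | a 0 ω ≤ 1} = P.real Set.univ := by
    refine measureReal_congr ?_
    filter_upwards [h.mem_Ioo 0] with ω hω
    exact propext (iff_of_true hω.2.le trivial)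
  rw [← h.cdf_eq 0 1 (by simp), this, probReal_univ]

lemma measureReal_lt [IsProbabilityMeasure P] (h : AssumptionG P a G β ν κ) (i : ℕ) {x : ℝ}
    (hx : x ∈ Set.Icc (0 : ℝ) 1) : P.real {ω | x < a i ω} = 1 - G x := by
  have h1 := probReal_compl_eq_one_sub (μ := P) (h.measurable i (measurableSet_Iic (a := x)))
  have h2 : (a i ⁻¹' Set.Iic x)ᶜ = {ω | x < a i ω} := by
    ext ω
    simp
  rw [h2] at h1
  rw [h1, ← h.cdf_eq i x hx]
  rfl

/-- `G` has no jump at `1`, because the sample almost surely avoids `1`. -/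
lemma tendsto_nhdsLT_one [IsProbabilityMeasure P] (h : AssumptionG P a G β ν κ) :
    Tendsto G (𝓝[<] 1) (𝓝 1) := by
  set μ := P.map (a 0) with hμ
  have hm := h.measurable 0
  have : IsProbabilityMeasure μ := Measure.isProbabilityMeasure_map hm.aemeasurable
  have hcdf : ∀ x ∈ Set.Icc (0 : ℝ) 1, cdf μ x = G x := by
    intro x hx
    rw [cdf_eq_real, hμ, map_measureReal_apply hm measurableSet_Iic, ← h.cdf_eq 0 x hx]
    rfl
  have h0 : μ {1} = 0 := by
    rw [hμ, Measure.map_apply hm (measurableSet_singleton _)]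
    refine measure_mono_null ?_ (ae_iff.1 (h.mem_Ioo 0))
    intro ω hω hω'
    exact hω'.2.ne hω
  have hleft : 1 ≤ Function.leftLim (cdf μ) 1 := by
    rw [← measure_cdf μ, StieltjesFunction.measure_singleton, ENNReal.ofReal_eq_zero,
      hcdf 1 (by simp), h.apply_one] at h0
    linarith
  have hle : Function.leftLim (cdf μ) 1 ≤ 1 :=
    ((monotone_cdf μ).leftLim_le le_rfl).trans (cdf_le_one μ 1)
  have hlim := (monotone_cdf μ).tendsto_leftLim 1
  rw [le_antisymm hle hleft] at hlim
  refine hlim.congr' ?_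
  filter_upwards [Ioo_mem_nhdsLT (zero_lt_one (α := ℝ))] with x hx
  exact hcdf x ⟨hx.1.le, hx.2.le⟩

/-- Integrating the density assumption: the tail `T u = 1 - G (1 - u)` is `κ u ^ β` up to a term of
order `u ^ (β + ν)`, and its slope on `[0, w]` is at most of order `w ^ (β - 1)`. -/
lemma exists_tail_bounds [IsProbabilityMeasure P] (h : AssumptionG P a G β ν κ) :
    ∃ u₀ ∈ Set.Ioo (0 : ℝ) 1, ∃ C : ℝ, 0 ≤ C ∧
      (∀ u ∈ Set.Icc 0 u₀, |(1 - G (1 - u)) - κ * u ^ β| ≤ C * u ^ (β + ν)) ∧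
      ∀ v w, 0 ≤ v → v ≤ w → w ≤ u₀ →
        (1 - G (1 - w)) - (1 - G (1 - v)) ≤ C * w ^ (β - 1) * (w - v) := by
  obtain ⟨ε, hε, g, R, -, hderiv, hg, hR⟩ := h.density
  obtain ⟨c, hc0, hc⟩ := hR.exists_nonneg
  obtain ⟨b, hb, hbR⟩ := (mem_nhdsLT_iff_exists_Ioo_subset' (zero_lt_one (α := ℝ))).1 hc.bound
  have hβ := h.one_lt_beta
  have hν := h.nu_pos
  have hκ := h.kappa_pos
  set T : ℝ → ℝ := fun u => 1 - G (1 - u) with hT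
  set u₁ := min ε (1 - b)
  have hu₁ : 0 < u₁ := lt_min hε.1 (by linarith [Set.mem_Iio.1 hb])
  have hu₁ε : u₁ ≤ ε := min_le_left _ _
  have hu₁b : u₁ ≤ 1 - b := min_le_right _ _
  have hT' : ∀ u ∈ Set.Ioo 0 u₁, HasDerivAt T (g (1 - u)) u := by
    intro u hu
    have h1 : HasDerivAt (fun u : ℝ => 1 - u) (-1) u := by
      simpa using (hasDerivAt_id u).const_sub 1
    have h2 := (hderiv (1 - u) ⟨by linarith [hu.2], by linarith [hu.1]⟩).comp u h1
    simpa using h2.const_sub 1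
  have hgu : ∀ u ∈ Set.Ioo 0 u₁, g (1 - u) = κ * β * u ^ (β - 1) * (1 + R (1 - u)) ∧
      |R (1 - u)| ≤ c * u ^ ν := by
    intro u hu
    constructor
    · rw [hg (1 - u) ⟨by linarith [hu.2], by linarith [hu.1]⟩]
      simp
    · have h1 : 1 - u ∈ Set.Ioo b 1 := ⟨by linarith [hu.2], by linarith [hu.1]⟩
      have h2 := hbR h1
      simp only [Set.mem_ofPred_eq, Real.norm_eq_abs, sub_sub_cancel] at h2
      rwa [abs_of_nonneg (Real.rpow_nonneg hu.1.le ν)] at h2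
  have hT0 : T 0 = 0 := by simp [hT, h.apply_one]
  have hTc : ContinuousOn T (Set.Icc 0 (u₁ / 2)) := by
    intro u hu
    rcases hu.1.eq_or_lt with rfl | hpos
    · have hcont : ContinuousWithinAt T (Set.Ioi 0) 0 := by
        unfold ContinuousWithinAt
        rw [hT0]
        have h1 : Tendsto (fun u : ℝ => 1 - u) (𝓝[>] 0) (𝓝[<] 1) := by
          refine tendsto_nhdsWithin_iff.2 ⟨?_, ?_⟩
          · have : Tendsto (fun u : ℝ => 1 - u) (𝓝 0) (𝓝 (1 - 0)) :=
              tendsto_const_nhds.sub tendsto_id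
            rw [sub_zero] at this
            exact this.mono_left nhdsWithin_le_nhds
          · filter_upwards [self_mem_nhdsWithin] with u hu
            simpa using hu
        simpa using (h.tendsto_nhdsLT_one.comp h1).const_sub 1
      exact (continuousWithinAt_Ioi_iff_Ici.1 hcont).mono Set.Icc_subset_Ici_self
    · exact (hT' u ⟨hpos, by linarith [hu.2]⟩).continuousAt.continuousWithinAt
  set u₀ := u₁ / 2
  have hu₀ : u₀ < u₁ := by simp only [u₀]; linarith
  have hsub : ∀ u ∈ Set.Ioo 0 u₀, u ∈ Set.Ioo 0 u₁ := fun u hu => ⟨hu.1, hu.2.trans hu₀⟩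
  have hu₀1 : u₀ < 1 := by linarith [hε.2]
  set A := κ * β * c / (β + ν)
  have hA : A * (β + ν) = κ * β * c := div_mul_cancel₀ _ (by linarith)
  have hA0 : 0 ≤ A := by positivity
  have hpow : ∀ s : ℝ, 0 < s → ContinuousOn (fun u : ℝ => u ^ s) (Set.Icc 0 u₀) := fun s hs =>
    (Real.continuous_rpow_const hs.le).continuousOn
  have hbd : ∀ u ∈ Set.Ioo 0 u₀,
      |g (1 - u) - κ * (β * u ^ (β - 1))| ≤ A * ((β + ν) * u ^ (β + ν - 1)) := by
    intro u hu
    obtain ⟨h1, h2⟩ := hgu u (hsub u hu)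
    have h3 : u ^ (β + ν - 1) = u ^ (β - 1) * u ^ ν := by
      rw [← Real.rpow_add hu.1]; ring_nf
    have h4 : 0 ≤ u ^ (β - 1) := Real.rpow_nonneg hu.1.le _
    rw [h1, ← mul_assoc A, hA, h3,
      show κ * β * u ^ (β - 1) * (1 + R (1 - u)) - κ * (β * u ^ (β - 1))
        = κ * β * u ^ (β - 1) * R (1 - u) by ring, abs_mul, abs_of_nonneg (by positivity)]
    calc κ * β * u ^ (β - 1) * |R (1 - u)| ≤ κ * β * u ^ (β - 1) * (c * u ^ ν) := by gcongr
      _ = _ := by ring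
  have key : ∀ σ : ℝ, (σ = 1 ∨ σ = -1) → ∀ u ∈ Set.Icc 0 u₀,
      0 ≤ A * u ^ (β + ν) + σ * (T u - κ * u ^ β) := by
    intro σ hσ u hu
    have hd : ∀ x ∈ Set.Ioo 0 u₀, HasDerivAt
        (fun u => A * u ^ (β + ν) + σ * (T u - κ * u ^ β))
        (A * ((β + ν) * x ^ (β + ν - 1)) + σ * (g (1 - x) - κ * (β * x ^ (β - 1)))) x := by
      intro x hx
      exact ((Real.hasDerivAt_rpow_const (Or.inl hx.1.ne')).const_mul A).add
        (((hT' x (hsub x hx)).sub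
          ((Real.hasDerivAt_rpow_const (Or.inl hx.1.ne')).const_mul κ)).const_mul σ)
    have hmono : MonotoneOn (fun u => A * u ^ (β + ν) + σ * (T u - κ * u ^ β))
        (Set.Icc 0 u₀) := by
      refine monotoneOn_of_deriv_nonneg (convex_Icc _ _) ?_ ?_ ?_
      · exact ((hpow _ (by linarith)).const_smul A).add
          ((hTc.sub ((hpow _ (by linarith)).const_smul κ)).const_smul σ)
      · rw [interior_Icc]
        exact fun x hx => (hd x hx).differentiableAt.differentiableWithinAt
      · rw [interior_Icc]
        intro x hx
        rw [(hd x hx).deriv]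
        have := abs_le.1 (hbd x hx)
        rcases hσ with rfl | rfl <;> linarith [this.1, this.2]
    have h0 := hmono (Set.left_mem_Icc.2 (hu.1.trans hu.2)) hu hu.1
    simpa [hT0, Real.zero_rpow (by linarith : β + ν ≠ 0), Real.zero_rpow (by linarith : β ≠ 0)]
      using h0
  refine ⟨u₀, ⟨by positivity, hu₀1⟩, max A (κ * β * (1 + c)), hA0.trans (le_max_left _ _), ?_, ?_⟩
  · intro u hu
    have h1 := key 1 (Or.inl rfl) u hu
    have h2 := key (-1) (Or.inr rfl) u hu
    refine (abs_le.2 ⟨by linarith, by linarith⟩ : |T u - κ * u ^ β| ≤ A * u ^ (β + ν)).trans ?_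
    exact mul_le_mul_of_nonneg_right (le_max_left _ _) (Real.rpow_nonneg hu.1 _)
  · intro v w hv hvw hw
    have hsubIcc : Set.Icc v w ⊆ Set.Icc 0 u₀ := Set.Icc_subset_Icc hv hw
    have hsubIoo : ∀ x ∈ Set.Ioo v w, x ∈ Set.Ioo 0 u₀ :=
      fun x hx => ⟨hv.trans_lt hx.1, hx.2.trans_le hw⟩
    have h1 := Convex.image_sub_le_mul_sub_of_deriv_le (convex_Icc v w) (hTc.mono hsubIcc)
      (by
        rw [interior_Icc]
        exact fun x hx =>
          (hT' x (hsub x (hsubIoo x hx))).differentiableAt.differentiableWithinAt)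
      (C := κ * β * (1 + c) * w ^ (β - 1))
      (by
        rw [interior_Icc]
        intro x hx
        have hx0 := hsubIoo x hx
        rw [(hT' x (hsub x hx0)).deriv]
        obtain ⟨h2, h3⟩ := hgu x (hsub x hx0)
        have h4 : x ^ ν ≤ 1 := Real.rpow_le_one hx0.1.le (by linarith [hx0.2]) hν.le
        have h5 : 1 + R (1 - x) ≤ 1 + c := by
          nlinarith [le_abs_self (R (1 - x))]
        have h6 : x ^ (β - 1) ≤ w ^ (β - 1) :=
          Real.rpow_le_rpow hx0.1.le hx.2.le (by linarith)
        rw [h2]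
        calc κ * β * x ^ (β - 1) * (1 + R (1 - x)) ≤ κ * β * x ^ (β - 1) * (1 + c) :=
              mul_le_mul_of_nonneg_left h5
                (mul_nonneg (by positivity) (Real.rpow_nonneg hx0.1.le _))
          _ ≤ κ * β * w ^ (β - 1) * (1 + c) := by gcongr
          _ = _ := by ring)
      v (Set.left_mem_Icc.2 hvw) w (Set.right_mem_Icc.2 hvw) hvw
    refine h1.trans ?_
    have := Real.rpow_nonneg (hv.trans hvw) (β - 1)
    have := sub_nonneg.2 hvw
    gcongr
    exact le_max_right _ _

end AssumptionG

/-! ### Layer-cake formulas for a nonnegative bounded variable -/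

section LayerCake

variable {Ω : Type*} [MeasurableSpace Ω] {P : Measure Ω}

lemma setIntegral_indicator_Iio {E : Type*} [NormedAddCommGroup E] [NormedSpace ℝ E]
    (f : ℝ → E) {y L : ℝ} (hy0 : 0 ≤ y) (hyL : y ≤ L) :
    ∫ t in Set.Ico 0 L, (Set.Iio y).indicator f t = ∫ t in (0)..y, f t := by
  rw [setIntegral_indicator measurableSet_Iio, intervalIntegral.integral_of_le hy0,
    integral_Ioc_eq_integral_Ioo, ← integral_Ico_eq_integral_Ioo]
  congr 2
  ext t
  simp only [Set.mem_inter_iff, Set.mem_Ico, Set.mem_Iio]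
  constructor
  · rintro ⟨⟨h1, -⟩, h2⟩
    exact ⟨h1, h2⟩
  · rintro ⟨h1, h2⟩
    exact ⟨⟨h1, h2.trans_le hyL⟩, h2⟩

/-- Fubini for a measurable family of events `A t`, `0 ≤ t < L`, weighted by `f t`. -/
lemma integral_setIntegral_indicator [IsFiniteMeasure P] {E : Type*} [NormedAddCommGroup E]
    [NormedSpace ℝ E] [CompleteSpace E] {L : ℝ} {f : ℝ → E}
    (hf : IntegrableOn f (Set.Ico 0 L)) {A : Set (Ω × ℝ)} (hA : MeasurableSet A) :
    Integrable (fun ω => ∫ t in Set.Ico 0 L, A.indicator (fun z => f z.2) (ω, t)) P ∧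
    Integrable (fun t => P.real {ω | (ω, t) ∈ A} • f t) (volume.restrict (Set.Ico 0 L)) ∧
    ∫ ω, (∫ t in Set.Ico 0 L, A.indicator (fun z => f z.2) (ω, t)) ∂P =
      ∫ t in Set.Ico 0 L, P.real {ω | (ω, t) ∈ A} • f t := by
  have hint : Integrable (A.indicator fun z : Ω × ℝ => f z.2)
      (P.prod (volume.restrict (Set.Ico 0 L))) :=
    (hf.integrable.comp_snd P).indicator hA
  have hsec : ∀ t, ∫ ω, A.indicator (fun z => f z.2) (ω, t) ∂P = P.real {ω | (ω, t) ∈ A} • f t := by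
    intro t
    have hAt : MeasurableSet {ω | (ω, t) ∈ A} := measurable_prodMk_right hA
    rw [← integral_indicator_const _ hAt]
    rfl
  refine ⟨hint.integral_prod_left, ?_, ?_⟩
  · have := hint.integral_prod_right
    simpa only [hsec] using this
  · rw [integral_integral_swap (f := fun ω t => A.indicator (fun z => f z.2) (ω, t)) hint]
    simp only [hsec]

/-- Two variables with values in `[0, L]` whose superlevel sets differ with probability at most `B`
are at `L¹` distance at most `L B`. -/
lemma integral_abs_sub_le [IsFiniteMeasure P] {Y Y' : Ω → ℝ} {L B : ℝ} (hL : 0 ≤ L)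
    (hY : Measurable Y) (hY' : Measurable Y')
    (hYL : ∀ ω, Y ω ∈ Set.Icc 0 L) (hYL' : ∀ ω, Y' ω ∈ Set.Icc 0 L)
    (hB : ∀ t ∈ Set.Ico 0 L, P.real {ω | ¬(t < Y ω ↔ t < Y' ω)} ≤ B) :
    ∫ ω, |Y ω - Y' ω| ∂P ≤ L * B := by
  set A : Set (Ω × ℝ) := {z | ¬(z.2 < Y z.1 ↔ z.2 < Y' z.1)} with hAdef
  have h1 : MeasurableSet {z : Ω × ℝ | z.2 < Y z.1} :=
    measurableSet_lt measurable_snd (hY.comp measurable_fst)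
  have h2 : MeasurableSet {z : Ω × ℝ | z.2 < Y' z.1} :=
    measurableSet_lt measurable_snd (hY'.comp measurable_fst)
  have hA : MeasurableSet A := (h1.iff h2).compl
  have hf : IntegrableOn (fun _ : ℝ => (1 : ℝ)) (Set.Ico 0 L) := by simp
  obtain ⟨hi1, hi2, heq⟩ := integral_setIntegral_indicator (P := P) hf hA
  have hindi : ∀ y : ℝ, IntegrableOn ((Set.Iio y).indicator fun _ => (1 : ℝ)) (Set.Ico 0 L) :=
    fun y => hf.indicator measurableSet_Iio
  have hval : ∀ y ∈ Set.Icc 0 L,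
      ∫ t in Set.Ico 0 L, (Set.Iio y).indicator (fun _ => (1 : ℝ)) t = y := by
    intro y hy
    rw [setIntegral_indicator_Iio _ hy.1 hy.2]
    simp
  have hpt : ∀ ω, |Y ω - Y' ω| ≤
      ∫ t in Set.Ico 0 L, A.indicator (fun _ => (1 : ℝ)) (ω, t) := by
    intro ω
    rw [← hval _ (hYL ω), ← hval _ (hYL' ω), ← integral_sub (hindi _) (hindi _)]
    refine (abs_integral_le_integral_abs).trans (le_of_eq ?_)
    congr 1
    ext t
    simp only [Set.indicator, Set.mem_Iio, hAdef, Set.mem_ofPred_eq]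
    by_cases ha : t < Y ω <;> by_cases hb : t < Y' ω <;> simp [ha, hb]
  have hbd : Integrable (fun ω => |Y ω - Y' ω|) P :=
    Integrable.mono' hi1 (hY.sub hY').abs.aestronglyMeasurable
      (ae_of_all _ fun ω => by simpa using hpt ω)
  calc ∫ ω, |Y ω - Y' ω| ∂P
      ≤ ∫ ω, (∫ t in Set.Ico 0 L, A.indicator (fun _ => (1 : ℝ)) (ω, t)) ∂P :=
        integral_mono hbd hi1 hpt
    _ = ∫ t in Set.Ico 0 L, P.real {ω | (ω, t) ∈ A} • (1 : ℝ) := heq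
    _ ≤ ∫ _ in Set.Ico 0 L, B := by
        refine setIntegral_mono_on hi2 (by simp) measurableSet_Ico fun t ht => ?_
        simpa only [smul_eq_mul, mul_one] using! hB t ht
    _ = L * B := by simp [hL]

/-- The number `c₀ 1(0 < y) + c₁ y`: a linear combination of the exceedance indicator and of the
logarithmic excess `y`. -/
noncomputable def jumpAffine (c₀ c₁ y : ℝ) : ℝ := (if 0 < y then c₀ else 0) + c₁ * y

@[fun_prop]
lemma measurable_jumpAffine (c₀ c₁ : ℝ) : Measurable (jumpAffine c₀ c₁) := by
  unfold jumpAffine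
  exact (Measurable.ite measurableSet_Ioi measurable_const measurable_const).add
    (measurable_id.const_mul c₁)

/-- The characteristic function of `c₀ 1(0 < Y) + c₁ Y` in terms of the tail of `Y`. -/
lemma charFun_map_jumpAffine [IsProbabilityMeasure P] {Y : Ω → ℝ} {L : ℝ}
    (hY : Measurable Y) (hYL : ∀ ω, Y ω ∈ Set.Icc 0 L) (c₀ c₁ s : ℝ) :
    IntegrableOn (fun t : ℝ => (P.real {ω | t < Y ω} : ℂ) *
      (s * c₁ * Complex.I * Complex.exp (s * (c₀ + c₁ * t) * Complex.I))) (Set.Ico 0 L) ∧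
    charFun (P.map fun ω => jumpAffine c₀ c₁ (Y ω)) s =
      1 + ((P.real {ω | 0 < Y ω} : ℂ) * (Complex.exp (s * c₀ * Complex.I) - 1) +
        ∫ t in Set.Ico 0 L, (P.real {ω | t < Y ω} : ℂ) *
          (s * c₁ * Complex.I * Complex.exp (s * (c₀ + c₁ * t) * Complex.I))) := by
  set f : ℝ → ℂ := fun t => s * c₁ * Complex.I * Complex.exp (s * (c₀ + c₁ * t) * Complex.I)
    with hfdef
  have hfc : Continuous f := by simp only [hfdef]; fun_prop
  have hf : IntegrableOn f (Set.Ico 0 L) :=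
    (hfc.integrableOn_Icc (a := 0) (b := L)).mono_set Set.Ico_subset_Icc_self
  have hA : MeasurableSet {z : Ω × ℝ | z.2 < Y z.1} :=
    measurableSet_lt measurable_snd (hY.comp measurable_fst)
  obtain ⟨hi1, hi2, heq⟩ := integral_setIntegral_indicator (P := P) hf hA
  simp only [Set.mem_ofPred_eq, Complex.real_smul] at hi2 heq
  refine ⟨hi2, ?_⟩
  have hderiv : ∀ t : ℝ, HasDerivAt
      (fun t : ℝ => Complex.exp (s * (c₀ + c₁ * t) * Complex.I)) (f t) t := by
    intro t
    have h1 : HasDerivAt (fun t : ℝ => (s * (c₀ + c₁ * t) * Complex.I : ℂ))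
        (s * (c₁ * 1) * Complex.I) t :=
      ((((Complex.ofRealCLM.hasDerivAt (x := t)).const_mul (c₁ : ℂ)).const_add
        (c₀ : ℂ)).const_mul (s : ℂ)).mul_const Complex.I
    convert! h1.cexp using 1
    simp only [hfdef]
    ring
  have hpt : ∀ ω, Complex.exp (s * jumpAffine c₀ c₁ (Y ω) * Complex.I) =
      1 + ({ω | 0 < Y ω}.indicator (fun _ => Complex.exp (s * c₀ * Complex.I) - 1) ω +
      ∫ t in Set.Ico 0 L, {z : Ω × ℝ | z.2 < Y z.1}.indicator (fun z => f z.2) (ω, t)) := by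
    intro ω
    have h1 : ∫ t in Set.Ico 0 L, {z : Ω × ℝ | z.2 < Y z.1}.indicator (fun z => f z.2) (ω, t)
        = ∫ t in (0)..(Y ω), f t := by
      rw [← setIntegral_indicator_Iio f (hYL ω).1 (hYL ω).2]
      rfl
    rw [h1, intervalIntegral.integral_eq_sub_of_hasDerivAt (fun t _ => hderiv t)
      (hfc.intervalIntegrable _ _)]
    by_cases h0 : 0 < Y ω
    · simp [jumpAffine, h0]
    · have h2 : Y ω = 0 := le_antisymm (not_lt.1 h0) (hYL ω).1
      simp [jumpAffine, h2]
  rw [charFun_apply_real, integral_map (by fun_prop) (by fun_prop)]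
  simp only [hpt]
  have h0m : MeasurableSet {ω | 0 < Y ω} := measurableSet_lt measurable_const hY
  have hi0 : Integrable ({ω | 0 < Y ω}.indicator
      (fun _ => Complex.exp (s * c₀ * Complex.I) - 1)) P := (integrable_const _).indicator h0m
  have hadd := integral_add (μ := P) (integrable_const (1 : ℂ)) (hi0.add hi1)
  simp only [Pi.add_apply] at hadd
  rw [hadd, integral_add hi0 hi1, heq,
    integral_indicator_const _ h0m]
  simp [hfdef]

/-- If the tail of `Y` is close to that of `A` times an exponential law of rate `β`, the
characteristic function of `c₀ 1(0 < Y) + c₁ Y` is close to the one computed from that law. -/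
lemma norm_charFun_jumpAffine_sub_le [IsProbabilityMeasure P] {Y : Ω → ℝ} {L : ℝ} (hL : 0 < L)
    (hY : Measurable Y) (hYL : ∀ ω, Y ω ∈ Set.Icc 0 L) (c₀ c₁ s : ℝ) {A D β : ℝ} (hβ : 0 < β)
    (hA : 0 ≤ A) (hD : 0 ≤ D)
    (hQ : ∀ t ∈ Set.Ico 0 L,
      |P.real {ω | t < Y ω} - A * Real.exp (-β * t)| ≤ D * Real.exp (-β * t)) :
    ‖charFun (P.map fun ω => jumpAffine c₀ c₁ (Y ω)) s - 1 -
        A * (Complex.exp (s * c₀ * Complex.I) * (β / (β - s * c₁ * Complex.I)) - 1)‖ ≤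
      |s| * (D * |c₀| + (D + A * Real.exp (-β * L)) / β * |c₁|) := by
  obtain ⟨hint, heq⟩ := charFun_map_jumpAffine (P := P) hY hYL c₀ c₁ s
  set f : ℝ → ℂ := fun t => s * c₁ * Complex.I * Complex.exp (s * (c₀ + c₁ * t) * Complex.I)
    with hfdef
  set q : ℝ → ℝ := fun t => P.real {ω | t < Y ω}
  set e₀ := Complex.exp (s * c₀ * Complex.I)
  set z : ℂ := s * c₁ * Complex.I - β
  have hzre : z.re = -β := by simp [z]
  have hzn : β ≤ ‖z‖ := by
    have := Complex.abs_re_le_norm z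
    rwa [hzre, abs_neg, abs_of_pos hβ] at this
  have hz0 : z ≠ 0 := norm_pos_iff.1 (hβ.trans_le hzn)
  have hfn : ∀ t, ‖f t‖ = |s| * |c₁| := by
    intro t
    have : ‖Complex.exp (s * (c₀ + c₁ * t) * Complex.I)‖ = 1 := by
      have := Complex.norm_exp_ofReal_mul_I (s * (c₀ + c₁ * t))
      push_cast at this
      exact this
    simp only [hfdef, norm_mul, this, Complex.norm_real, Complex.norm_I, Real.norm_eq_abs]
    ring
  have hfexp : ∀ t : ℝ, (A * Real.exp (-β * t) : ℂ) * f t =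
      A * (s * c₁ * Complex.I * e₀) * Complex.exp (z * t) := by
    intro t
    have : Complex.exp (s * (c₀ + c₁ * t) * Complex.I) * (Real.exp (-β * t) : ℂ)
        = e₀ * Complex.exp (z * t) := by
      rw [Complex.ofReal_exp, ← Complex.exp_add, ← Complex.exp_add]
      congr 1
      simp only [z]
      push_cast
      ring
    simp only [hfdef]
    linear_combination (A * (s * c₁ * Complex.I)) * this
  -- The exponential part is integrated exactly over `[0, L)`; cutting the integral at `L` leaves
  -- the term bounded in `hterm3`.
  have hexpint : ∫ t in Set.Ico 0 L, (A * Real.exp (-β * t) : ℂ) * f t =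
      A * (s * c₁ * Complex.I * e₀) * ((Complex.exp (z * L) - 1) / z) := by
    simp only [hfexp]
    rw [integral_Ico_eq_integral_Ioo, ← integral_Ioc_eq_integral_Ioo,
      ← intervalIntegral.integral_of_le hL.le, intervalIntegral.integral_const_mul,
      integral_exp_mul_complex hz0]
    simp
  have hint2 : IntegrableOn (fun t : ℝ => (A * Real.exp (-β * t) : ℂ) * f t) (Set.Ico 0 L) := by
    have : Continuous fun t : ℝ => (A * Real.exp (-β * t) : ℂ) * f t := by
      simp only [hfdef]
      fun_prop
    exact (this.integrableOn_Icc (a := 0) (b := L)).mono_set Set.Ico_subset_Icc_self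
  have hdecomp : charFun (P.map fun ω => jumpAffine c₀ c₁ (Y ω)) s - 1 -
        A * (e₀ * (β / (β - s * c₁ * Complex.I)) - 1) =
      ((q 0 - A : ℝ) : ℂ) * (e₀ - 1) +
      (∫ t in Set.Ico 0 L, ((q t - A * Real.exp (-β * t) : ℝ) : ℂ) * f t) +
      A * (s * c₁ * Complex.I * e₀) * (Complex.exp (z * L) / z) := by
    have h1 : ∫ t in Set.Ico 0 L, ((q t - A * Real.exp (-β * t) : ℝ) : ℂ) * f t =
        (∫ t in Set.Ico 0 L, (q t : ℂ) * f t) -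
          A * (s * c₁ * Complex.I * e₀) * ((Complex.exp (z * L) - 1) / z) := by
      rw [← hexpint, ← integral_sub hint hint2]
      congr 1
      ext t
      push_cast
      ring
    have h2 : (β : ℂ) / (β - s * c₁ * Complex.I) = -β / z := by
      rw [show z = -(β - s * c₁ * Complex.I) by simp only [z]; ring, neg_div_neg_eq]
    have h3 : (s * c₁ * Complex.I : ℂ) = z + β := by simp only [z]; ring
    have heq' : charFun (P.map fun ω => jumpAffine c₀ c₁ (Y ω)) s =
        1 + ((q 0 : ℂ) * (e₀ - 1) + ∫ t in Set.Ico 0 L, (q t : ℂ) * f t) := heq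
    rw [heq', h1, h2, h3]
    push_cast
    field_simp
    ring
  have he₀ : ‖e₀ - 1‖ ≤ |s| * |c₀| := by
    have := Real.norm_exp_I_mul_ofReal_sub_one_le (x := s * c₀)
    rw [Real.norm_eq_abs, abs_mul] at this
    convert! this using 4
    push_cast
    ring
  have he₀n : ‖e₀‖ = 1 := by
    have := Complex.norm_exp_ofReal_mul_I (s * c₀)
    push_cast at this
    exact this
  have hterm1 : ‖((q 0 - A : ℝ) : ℂ) * (e₀ - 1)‖ ≤ D * (|s| * |c₀|) := by
    rw [norm_mul, Complex.norm_real, Real.norm_eq_abs]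
    have := hQ 0 ⟨le_rfl, hL⟩
    simp only [mul_zero, Real.exp_zero, mul_one] at this
    gcongr
  have hterm2 : ‖∫ t in Set.Ico 0 L, ((q t - A * Real.exp (-β * t) : ℝ) : ℂ) * f t‖ ≤
      D / β * (|s| * |c₁|) := by
    have hexp : ∫ t in Set.Ico 0 L, D * Real.exp (-β * t) * (|s| * |c₁|) ≤
        D / β * (|s| * |c₁|) := by
      have hF : ∀ t : ℝ, HasDerivAt (fun t : ℝ => -(D / β * (|s| * |c₁|)) * Real.exp (-β * t))
          (D * Real.exp (-β * t) * (|s| * |c₁|)) t := by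
        intro t
        have h1 : HasDerivAt (fun t : ℝ => -β * t) (-β) t := by
          simpa using (hasDerivAt_id t).const_mul (-β)
        convert! h1.exp.const_mul (-(D / β * (|s| * |c₁|))) using 1
        field_simp
      rw [integral_Ico_eq_integral_Ioo, ← integral_Ioc_eq_integral_Ioo,
        ← intervalIntegral.integral_of_le hL.le,
        intervalIntegral.integral_eq_sub_of_hasDerivAt (fun t _ => hF t)
          (Continuous.intervalIntegrable (by fun_prop) _ _)]
      have : 0 ≤ D / β * (|s| * |c₁|) * Real.exp (-β * L) := by positivity
      simp only [mul_zero, Real.exp_zero, mul_one]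
      linarith
    refine le_trans ?_ hexp
    refine norm_integral_le_of_norm_le ?_ ?_
    · have : Continuous fun t : ℝ => D * Real.exp (-β * t) * (|s| * |c₁|) := by fun_prop
      exact (this.integrableOn_Icc (a := 0) (b := L)).mono_set Set.Ico_subset_Icc_self
    · refine (ae_restrict_iff' measurableSet_Ico).2 (ae_of_all _ fun t ht => ?_)
      rw [norm_mul, hfn, Complex.norm_real, Real.norm_eq_abs]
      gcongr
      exact hQ t ht
  have hterm3 : ‖A * (s * c₁ * Complex.I * e₀) * (Complex.exp (z * L) / z)‖ ≤
      A * (|s| * |c₁|) * (Real.exp (-β * L) / β) := by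
    have h1 : ‖Complex.exp (z * L)‖ = Real.exp (-β * L) := by
      rw [Complex.norm_exp]
      congr 1
      simp [hzre]
    rw [norm_mul, norm_mul, norm_mul, norm_mul, norm_mul, norm_div, h1, he₀n, Complex.norm_I]
    simp only [Complex.norm_real, Real.norm_eq_abs, mul_one, abs_of_nonneg hA]
    gcongr
  rw [hdecomp]
  refine (norm_add₃_le.trans (add_le_add_three hterm1 hterm2 hterm3)).trans (le_of_eq ?_)
  ring

end LayerCake

/-! ### Logarithmic excesses and their characteristic functions -/

section LogExcess

/-- The logarithmic excess `log (δ / (1 - m))` of the truncated observation `m = min y (1 - δ ^ r)`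
over the threshold `1 - δ`; it is `0` when the threshold is not exceeded. -/
noncomputable def logExcess (δ r y : ℝ) : ℝ :=
  if 1 - δ < min y (1 - δ ^ r) then Real.log (δ / (1 - min y (1 - δ ^ r))) else 0

@[fun_prop]
lemma measurable_logExcess (δ r : ℝ) : Measurable (logExcess δ r) := by
  unfold logExcess
  refine Measurable.ite (measurableSet_lt measurable_const (by fun_prop)) ?_ measurable_const
  exact Real.measurable_log.comp (by fun_prop)

variable {δ r : ℝ}

lemma logExcess_mem_Icc (hδ : 0 < δ) (hδ1 : δ < 1) (hr : 1 < r) (y : ℝ) :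
    logExcess δ r y ∈ Set.Icc 0 ((r - 1) * -Real.log δ) := by
  have hL : 0 < (r - 1) * -Real.log δ :=
    mul_pos (by linarith) (by linarith [Real.log_neg hδ hδ1])
  unfold logExcess
  split_ifs with h
  · set m := min y (1 - δ ^ r)
    have hm : m ≤ 1 - δ ^ r := min_le_right _ _
    have hδr : 0 < δ ^ r := Real.rpow_pos_of_pos hδ r
    have hu : 0 < 1 - m := by linarith
    constructor
    · exact Real.log_nonneg ((one_le_div hu).2 (by linarith))
    · rw [Real.log_div hδ.ne' hu.ne']
      have := Real.log_le_log hδr (by linarith : δ ^ r ≤ 1 - m)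
      rw [Real.log_rpow hδ] at this
      linarith
  · exact ⟨le_rfl, hL.le⟩

/-- Up to the maximal value, the excess passes `t` exactly when the untruncated observation passes
the level `1 - δ e ^ (-t)`. -/
lemma lt_logExcess_iff (hδ : 0 < δ) (hδ1 : δ < 1) (hr : 1 < r) (y : ℝ) {t : ℝ}
    (ht : t ∈ Set.Ico 0 ((r - 1) * -Real.log δ)) :
    t < logExcess δ r y ↔ 1 - δ * Real.exp (-t) < y := by
  have hδr : 0 < δ ^ r := Real.rpow_pos_of_pos hδ r
  have hδr' : δ ^ r < δ := by simpa using Real.rpow_lt_rpow_of_exponent_gt hδ hδ1 hr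
  unfold logExcess
  split_ifs with h
  · set m := min y (1 - δ ^ r)
    have hm : m ≤ 1 - δ ^ r := min_le_right _ _
    have hu : 0 < 1 - m := by linarith
    have h1 : t < Real.log (δ / (1 - m)) ↔ 1 - δ * Real.exp (-t) < m := by
      rw [Real.lt_log_iff_exp_lt (by positivity), lt_div_iff₀ hu, Real.exp_neg,
        ← div_eq_mul_inv, sub_lt_comm, lt_div_iff₀ (Real.exp_pos t), mul_comm]
    have h2 : 1 - δ * Real.exp (-t) < 1 - δ ^ r := by
      have h3 : δ ^ r = δ * Real.exp (-((r - 1) * -Real.log δ)) := by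
        rw [show -((r - 1) * -Real.log δ) = Real.log δ * (r - 1) by ring,
          ← Real.rpow_def_of_pos hδ, Real.rpow_sub_one hδ.ne']
        field_simp
      rw [h3]
      have : Real.exp (-((r - 1) * -Real.log δ)) < Real.exp (-t) :=
        Real.exp_lt_exp.2 (by linarith [ht.2])
      have := mul_lt_mul_of_pos_left this hδ
      linarith
    rw [h1, lt_min_iff]
    exact and_iff_left h2
  · have hy : y ≤ 1 - δ := by
      by_contra hlt
      exact h (lt_min (not_le.1 hlt) (by linarith))
    have h1 : δ * Real.exp (-t) ≤ δ := by
      have : Real.exp (-t) ≤ 1 := Real.exp_le_one_iff.2 (by linarith [ht.1])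
      nlinarith
    exact iff_of_false (not_lt.2 ht.1) (not_lt.2 (by linarith))

lemma noisyTailEstimator_eq_div (hδ : 0 < δ) (N : ℕ) (y : ℕ → ℝ) :
    noisyTailEstimator N δ r y =
      (∑ i ∈ Finset.range N, if 0 < logExcess δ r (y i) then (1 : ℝ) else 0) /
        ∑ i ∈ Finset.range N, logExcess δ r (y i) := by
  unfold noisyTailEstimator goldieSmith
  congr 1
  refine Finset.sum_congr rfl fun i _ => ?_
  have hδr : 0 < δ ^ r := Real.rpow_pos_of_pos hδ r
  by_cases h : 1 - δ < min (y i) (1 - δ ^ r)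
  · have hu : 0 < 1 - min (y i) (1 - δ ^ r) := by
      linarith [min_le_right (y i) (1 - δ ^ r)]
    have : 0 < logExcess δ r (y i) := by
      simp only [logExcess, h, if_true]
      exact Real.log_pos ((one_lt_div hu).2 (by linarith))
    simp [h, this]
  · have : logExcess δ r (y i) = 0 := by simp [logExcess, h]
    simp [h, this]

end LogExcess

section CleanSample

variable {Ω : Type*} [MeasurableSpace Ω] {P : Measure Ω} [IsProbabilityMeasure P]
  {a : ℕ → Ω → ℝ} {G : ℝ → ℝ} {β ν κ : ℝ}

lemma AssumptionG.measureReal_lt_logExcess (hG : AssumptionG P a G β ν κ) (i : ℕ) {δ r t : ℝ}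
    (hδ : 0 < δ) (hδ1 : δ < 1) (hr : 1 < r) (ht : t ∈ Set.Ico 0 ((r - 1) * -Real.log δ)) :
    P.real {ω | t < logExcess δ r (a i ω)} = 1 - G (1 - δ * Real.exp (-t)) := by
  have h1 : Real.exp (-t) ≤ 1 := Real.exp_le_one_iff.2 (by linarith [ht.1])
  have h2 := mul_pos hδ (Real.exp_pos (-t))
  have h3 : δ * Real.exp (-t) ≤ 1 := by nlinarith
  simp only [lt_logExcess_iff hδ hδ1 hr _ ht]
  exact hG.measureReal_lt i ⟨by linarith, by linarith⟩

/-- The characteristic function depends only on the tail of the excess, hence not on `i`. -/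
lemma AssumptionG.charFun_map_jumpAffine_eq (hG : AssumptionG P a G β ν κ) (i : ℕ) {δ r : ℝ}
    (hδ : 0 < δ) (hδ1 : δ < 1) (hr : 1 < r) (c₀ c₁ s : ℝ) :
    charFun (P.map fun ω => jumpAffine c₀ c₁ (logExcess δ r (a i ω))) s =
      charFun (P.map fun ω => jumpAffine c₀ c₁ (logExcess δ r (a 0 ω))) s := by
  have hm : ∀ j, Measurable fun ω => logExcess δ r (a j ω) := fun j =>
    (measurable_logExcess δ r).comp (hG.measurable j)
  have hL : 0 < (r - 1) * -Real.log δ :=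
    mul_pos (by linarith) (by linarith [Real.log_neg hδ hδ1])
  rw [(charFun_map_jumpAffine (hm i) (fun ω => logExcess_mem_Icc hδ hδ1 hr _) c₀ c₁ s).2,
    (charFun_map_jumpAffine (hm 0) (fun ω => logExcess_mem_Icc hδ hδ1 hr _) c₀ c₁ s).2]
  congr 2
  · rw [hG.measureReal_lt_logExcess i hδ hδ1 hr ⟨le_rfl, hL⟩,
      hG.measureReal_lt_logExcess 0 hδ hδ1 hr ⟨le_rfl, hL⟩]
  · refine setIntegral_congr_fun measurableSet_Ico fun t ht => ?_
    rw [hG.measureReal_lt_logExcess i hδ hδ1 hr ht, hG.measureReal_lt_logExcess 0 hδ hδ1 hr ht]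

lemma AssumptionG.charFun_map_sum_jumpAffine (hG : AssumptionG P a G β ν κ) {δ r : ℝ}
    (hδ : 0 < δ) (hδ1 : δ < 1) (hr : 1 < r) (N : ℕ) (c₀ c₁ s : ℝ) :
    charFun (P.map fun ω => ∑ i ∈ Finset.range N, jumpAffine c₀ c₁ (logExcess δ r (a i ω))) s =
      (charFun (P.map fun ω => jumpAffine c₀ c₁ (logExcess δ r (a 0 ω))) s) ^ N := by
  have hg : Measurable fun y => jumpAffine c₀ c₁ (logExcess δ r y) := by fun_prop
  have hind : iIndepFun (fun i ω => jumpAffine c₀ c₁ (logExcess δ r (a i ω))) P :=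
    hG.indep.comp (fun _ y => jumpAffine c₀ c₁ (logExcess δ r y)) fun _ => hg
  have hm : ∀ i, AEMeasurable (fun ω => jumpAffine c₀ c₁ (logExcess δ r (a i ω))) P := fun i =>
    (hg.comp (hG.measurable i)).aemeasurable
  rw [(hind.restrict _).charFun_map_fun_finsetSum_eq_prod (fun i _ => hm i), Finset.prod_apply]
  simp [hG.charFun_map_jumpAffine_eq _ hδ hδ1 hr]

/-- The characteristic function of one summand, up to the bias caused by the deviation of `G` from
a pure power law (the term in `δ ^ ν`) and by the truncation (the term in `δ ^ ((r - 1) β)`). -/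
lemma AssumptionG.exists_charFun_bound (hG : AssumptionG P a G β ν κ) {r : ℝ} (hr : 1 < r)
    (c₀ c₁ : ℝ) : ∃ u₀ ∈ Set.Ioo (0 : ℝ) 1, ∃ K : ℝ, ∀ δ s : ℝ, 0 < δ → δ ≤ u₀ →
      ‖charFun (P.map fun ω => jumpAffine c₀ c₁ (logExcess δ r (a 0 ω))) s - 1 -
        (κ * δ ^ β : ℝ) *
          (Complex.exp (s * c₀ * Complex.I) * (β / (β - s * c₁ * Complex.I)) - 1)‖ ≤
      K * (|s| * δ ^ β * (δ ^ ν + δ ^ ((r - 1) * β))) := by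
  obtain ⟨u₀, hu₀, C, hC, htail, -⟩ := hG.exists_tail_bounds
  have hβ := hG.one_lt_beta
  have hκ := hG.kappa_pos
  have hν := hG.nu_pos
  refine ⟨u₀, hu₀, C * |c₀| + (C + κ) / β * |c₁|, fun δ s hδ hδu => ?_⟩
  have hδ1 : δ < 1 := hδu.trans_lt hu₀.2
  have hL : 0 < (r - 1) * -Real.log δ :=
    mul_pos (by linarith) (by linarith [Real.log_neg hδ hδ1])
  have hδβ : 0 < δ ^ β := Real.rpow_pos_of_pos hδ β
  have hδν : 0 < δ ^ ν := Real.rpow_pos_of_pos hδ ν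
  have hδt : 0 < δ ^ ((r - 1) * β) := Real.rpow_pos_of_pos hδ _
  have hpow : ∀ t b : ℝ, (δ * Real.exp (-t)) ^ b = δ ^ b * Real.exp (-b * t) := by
    intro t b
    rw [Real.mul_rpow hδ.le (Real.exp_pos _).le, ← Real.exp_mul]
    ring_nf
  have hQ : ∀ t ∈ Set.Ico 0 ((r - 1) * -Real.log δ),
      |P.real {ω | t < logExcess δ r (a 0 ω)} - κ * δ ^ β * Real.exp (-β * t)| ≤
        C * (δ ^ β * δ ^ ν) * Real.exp (-β * t) := by
    intro t ht
    have h1 : Real.exp (-t) ≤ 1 := Real.exp_le_one_iff.2 (by linarith [ht.1])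
    have h2 := mul_pos hδ (Real.exp_pos (-t))
    have h3 : δ * Real.exp (-t) ≤ δ := by nlinarith
    have h4 := htail (δ * Real.exp (-t)) ⟨h2.le, h3.trans hδu⟩
    rw [hG.measureReal_lt_logExcess 0 hδ hδ1 hr ht, mul_assoc κ, ← hpow]
    refine h4.trans ?_
    rw [hpow, Real.rpow_add hδ, ← mul_assoc]
    gcongr
    · exact ht.1
    · linarith
  have hexp : Real.exp (-β * ((r - 1) * -Real.log δ)) = δ ^ ((r - 1) * β) := by
    rw [Real.rpow_def_of_pos hδ]
    ring_nf
  have hmain := norm_charFun_jumpAffine_sub_le (P := P) (s := s) hL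
    ((measurable_logExcess δ r).comp (hG.measurable 0))
    (fun ω => logExcess_mem_Icc hδ hδ1 hr (a 0 ω)) c₀ c₁ (A := κ * δ ^ β) (by linarith)
    (by positivity) (by positivity) hQ
  refine hmain.trans ?_
  rw [hexp]
  have e1 : C * (δ ^ β * δ ^ ν) ≤ C * (δ ^ β * (δ ^ ν + δ ^ ((r - 1) * β))) := by
    gcongr
    linarith
  have e2 : C * (δ ^ β * δ ^ ν) + κ * δ ^ β * δ ^ ((r - 1) * β) ≤
      (C + κ) * (δ ^ β * (δ ^ ν + δ ^ ((r - 1) * β))) := by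
    have : 0 ≤ C * (δ ^ β * δ ^ ((r - 1) * β)) + κ * (δ ^ β * δ ^ ν) := by positivity
    nlinarith
  have hβ0 : 0 < β := by linarith
  calc |s| * (C * (δ ^ β * δ ^ ν) * |c₀| +
        (C * (δ ^ β * δ ^ ν) + κ * δ ^ β * δ ^ ((r - 1) * β)) / β * |c₁|)
      ≤ |s| * (C * (δ ^ β * (δ ^ ν + δ ^ ((r - 1) * β))) * |c₀| +
        (C + κ) * (δ ^ β * (δ ^ ν + δ ^ ((r - 1) * β))) / β * |c₁|) := by gcongr
    _ = _ := by ring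

/-- Here `N δ ^ β` is the order of the number of exceedances, `hs` says that the bias vanishes in the
scaling `s`, and `w` is the limiting exponent computed from exponential excesses. -/
lemma AssumptionG.tendsto_charFun_sum (hG : AssumptionG P a G β ν κ) {r : ℝ} (hr : 1 < r)
    {δ : ℕ → ℝ} (hδ_pos : ∀ N, 0 < δ N) (hδ : Tendsto δ atTop (𝓝 0)) (c₀ c₁ : ℝ) {s : ℕ → ℝ}
    (hs : Tendsto (fun N : ℕ => |s N| * (N * δ N ^ β) * (δ N ^ ν + δ N ^ ((r - 1) * β)))
      atTop (𝓝 0)) {w : ℂ}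
    (hw : Tendsto (fun N : ℕ => ((N * δ N ^ β : ℝ) : ℂ) *
      (Complex.exp (s N * c₀ * Complex.I) * (β / (β - s N * c₁ * Complex.I)) - 1))
      atTop (𝓝 w)) :
    Tendsto (fun N => charFun (P.map fun ω =>
      ∑ i ∈ Finset.range N, jumpAffine c₀ c₁ (logExcess (δ N) r (a i ω))) (s N))
      atTop (𝓝 (Complex.exp (κ * w))) := by
  obtain ⟨u₀, hu₀, K, hK⟩ := hG.exists_charFun_bound hr c₀ c₁
  set z : ℕ → ℂ := fun N =>
    charFun (P.map fun ω => jumpAffine c₀ c₁ (logExcess (δ N) r (a 0 ω))) (s N) - 1 with hz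
  set b : ℕ → ℂ := fun N =>
    Complex.exp (s N * c₀ * Complex.I) * (β / (β - s N * c₁ * Complex.I)) - 1 with hb
  have hsmall : ∀ᶠ N in atTop, δ N ≤ u₀ := hδ.eventually (Iic_mem_nhds hu₀.1)
  have hdiff : Tendsto (fun N : ℕ => (N : ℂ) * z N - κ * (((N * δ N ^ β : ℝ) : ℂ) * b N))
      atTop (𝓝 0) := by
    have hs' := hs.const_mul K
    rw [mul_zero] at hs'
    refine squeeze_zero_norm' ?_ hs'
    filter_upwards [hsmall] with N hN
    have h1 := hK (δ N) (s N) (hδ_pos N) hN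
    have h2 : (N : ℂ) * z N - κ * (((N * δ N ^ β : ℝ) : ℂ) * b N) =
        (N : ℂ) * (z N - (κ * δ N ^ β : ℝ) * b N) := by
      push_cast
      ring
    rw [h2, norm_mul, Complex.norm_natCast]
    calc (N : ℝ) * ‖z N - (κ * δ N ^ β : ℝ) * b N‖
        ≤ N * (K * (|s N| * δ N ^ β * (δ N ^ ν + δ N ^ ((r - 1) * β)))) := by gcongr
      _ = _ := by ring
  have hNz : Tendsto (fun N : ℕ => (N : ℂ) * z N) atTop (𝓝 (κ * w)) := by
    have := hdiff.add (hw.const_mul (κ : ℂ))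
    rw [zero_add] at this
    exact this.congr fun N => by simp only [hb, sub_add_cancel]
  refine (Complex.tendsto_one_add_pow_exp_of_tendsto hNz).congr' ?_
  filter_upwards [hsmall] with N hN
  rw [hG.charFun_map_sum_jumpAffine (hδ_pos N) (hN.trans_lt hu₀.2) hr]
  simp [hz]

end CleanSample

/-! ### Limit theorems for the noiseless sample -/

/-- `e^{is} / (1 + is)` is the characteristic function of `1 - E` for a standard exponential
variable `E`, which has mean `0` and variance `1`. -/
lemma tendsto_mul_charFun_one_sub_exponential {M : ℕ → ℝ} (hM : Tendsto M atTop atTop) {β : ℝ}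
    (hβ : 0 < β) (t : ℝ) :
    Tendsto (fun N => (M N : ℂ) * (Complex.exp (((√(M N))⁻¹ * t : ℝ) * (1 : ℝ) * Complex.I) *
      (β / (β - ((√(M N))⁻¹ * t : ℝ) * (-β : ℝ) * Complex.I)) - 1)) atTop (𝓝 (-t ^ 2 / 2)) := by
  set z : ℕ → ℂ := fun N => ((√(M N))⁻¹ * t : ℝ) * Complex.I with hz
  have hinv : Tendsto (fun N => (√(M N))⁻¹) atTop (𝓝 0) :=
    tendsto_inv_atTop_zero.comp (Real.tendsto_sqrt_atTop.comp hM)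
  have hs : Tendsto (fun N => (√(M N))⁻¹ * t) atTop (𝓝 0) := by simpa using hinv.mul_const t
  have hz0 : Tendsto z atTop (𝓝 0) := by
    have : Tendsto (fun N => (((√(M N))⁻¹ * t : ℝ) : ℂ)) atTop (𝓝 ((0 : ℝ) : ℂ)) :=
      (Complex.continuous_ofReal.tendsto 0).comp hs
    simpa only [Complex.ofReal_zero, zero_mul] using this.mul_const Complex.I
  have hnorm : ∀ N, ‖z N‖ = (√(M N))⁻¹ * |t| := by
    intro N
    simp [hz, abs_of_nonneg (Real.sqrt_nonneg (M N))]
  have hsq : ∀ᶠ N in atTop, (M N : ℂ) * z N ^ 2 = -t ^ 2 := by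
    filter_upwards [hM.eventually_gt_atTop 0] with N hN
    have h1 : M N * ((√(M N))⁻¹ * t) ^ 2 = t ^ 2 := by
      rw [mul_pow, inv_pow, Real.sq_sqrt hN.le]
      field_simp
    have h2 : ((M N * ((√(M N))⁻¹ * t) ^ 2 : ℝ) : ℂ) = ((t ^ 2 : ℝ) : ℂ) := by rw [h1]
    simp only [hz, mul_pow, Complex.I_sq]
    push_cast at h2 ⊢
    linear_combination -h2
  have hrem : Tendsto (fun N => (M N : ℂ) * (Complex.exp (z N) - 1 - z N - z N ^ 2 / 2))
      atTop (𝓝 0) := by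
    have hb : Tendsto (fun N => |t| ^ 3 * (√(M N))⁻¹) atTop (𝓝 0) := by
      simpa using hinv.const_mul (|t| ^ 3)
    refine squeeze_zero_norm' ?_ hb
    have h1 : ∀ᶠ N in atTop, ‖z N‖ ≤ 1 := by
      have := hz0.norm
      rw [norm_zero] at this
      exact this.eventually (Iic_mem_nhds zero_lt_one)
    filter_upwards [hM.eventually_gt_atTop 0, h1] with N hN hN1
    have h2 := Complex.exp_bound hN1 (n := 3) (by norm_num)
    have h3 : Complex.exp (z N) - 1 - z N - z N ^ 2 / 2 =
        Complex.exp (z N) - ∑ m ∈ Finset.range 3, z N ^ m / (m.factorial : ℂ) := by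
      simp [Finset.sum_range_succ, Nat.factorial]
      ring
    rw [norm_mul, Complex.norm_real, Real.norm_eq_abs, abs_of_pos hN, h3]
    have h4 : ‖z N‖ ^ 3 * ((Nat.succ 3 : ℝ) * ((Nat.factorial 3 : ℝ) * (3 : ℕ))⁻¹) ≤
        ‖z N‖ ^ 3 := by
      refine mul_le_of_le_one_right (by positivity) ?_
      norm_num [Nat.factorial]
    have h5 : M N * (√(M N))⁻¹ ^ 2 = 1 := by
      rw [inv_pow, Real.sq_sqrt hN.le]
      field_simp
    calc M N * ‖Complex.exp (z N) - ∑ m ∈ Finset.range 3, z N ^ m / (m.factorial : ℂ)‖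
        ≤ M N * ‖z N‖ ^ 3 := by
          gcongr
          exact h2.trans h4
      _ = |t| ^ 3 * (√(M N))⁻¹ := by
          rw [hnorm]
          linear_combination ((√(M N))⁻¹ * |t| ^ 3) * h5
  have hnum : Tendsto (fun N => (M N : ℂ) * (Complex.exp (z N) - 1 - z N)) atTop
      (𝓝 (-t ^ 2 / 2)) := by
    have h1 : Tendsto (fun _ : ℕ => (-t ^ 2 / 2 : ℂ)) atTop (𝓝 (-t ^ 2 / 2)) := tendsto_const_nhds
    have h2 := hrem.add h1
    rw [zero_add] at h2
    refine h2.congr' ?_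
    filter_upwards [hsq] with N hN
    rw [← hN]
    ring
  have hden : Tendsto (fun N => 1 + z N) atTop (𝓝 1) := by simpa using hz0.const_add 1
  have hquot := hnum.div hden one_ne_zero
  rw [div_one] at hquot
  refine hquot.congr' ?_
  filter_upwards [hden.eventually_ne one_ne_zero] with N hN
  have h1 : (β : ℂ) / (β - ((√(M N))⁻¹ * t : ℝ) * (-β : ℝ) * Complex.I) = 1 / (1 + z N) := by
    have hβ' : (β : ℂ) ≠ 0 := by exact_mod_cast hβ.ne'
    have : (β : ℂ) - ((√(M N))⁻¹ * t : ℝ) * (-β : ℝ) * Complex.I = β * (1 + z N) := by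
      simp only [hz]
      push_cast
      ring
    rw [this]
    field_simp
  have h2 : Complex.exp (((√(M N))⁻¹ * t : ℝ) * (1 : ℝ) * Complex.I) = Complex.exp (z N) := by
    simp [hz]
  rw [h1, h2, Pi.div_apply]
  field_simp
  ring

/-- `β / (β - is)` is the characteristic function of an exponential variable of rate `β`. The factor
`exp 0` keeps the shape used for `c₀ 1(0 < ℓ) + c₁ ℓ`, here with `c₀ = 0` and `c₁ = 1`. -/
lemma tendsto_mul_charFun_exponential {M : ℕ → ℝ} (hM : Tendsto M atTop atTop) {β : ℝ}
    (hβ : 0 < β) (t : ℝ) :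
    Tendsto (fun N => (M N : ℂ) * (Complex.exp (((M N)⁻¹ * t : ℝ) * (0 : ℝ) * Complex.I) *
      (β / (β - ((M N)⁻¹ * t : ℝ) * (1 : ℝ) * Complex.I)) - 1)) atTop
      (𝓝 (t * Complex.I / β)) := by
  set z : ℕ → ℂ := fun N => ((M N)⁻¹ * t : ℝ) * Complex.I with hz
  have hs : Tendsto (fun N => (M N)⁻¹ * t) atTop (𝓝 0) := by
    simpa using (tendsto_inv_atTop_zero.comp hM).mul_const t
  have hz0 : Tendsto z atTop (𝓝 0) := by
    have : Tendsto (fun N => (((M N)⁻¹ * t : ℝ) : ℂ)) atTop (𝓝 ((0 : ℝ) : ℂ)) :=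
      (Complex.continuous_ofReal.tendsto 0).comp hs
    simpa only [Complex.ofReal_zero, zero_mul] using this.mul_const Complex.I
  have hβ' : (β : ℂ) ≠ 0 := by exact_mod_cast hβ.ne'
  have hden : Tendsto (fun N => (β : ℂ) - z N) atTop (𝓝 β) := by
    simpa using hz0.const_sub (β : ℂ)
  have hlim : Tendsto (fun N => t * Complex.I / ((β : ℂ) - z N)) atTop (𝓝 (t * Complex.I / β)) :=
    tendsto_const_nhds.div hden hβ'
  refine hlim.congr' ?_
  filter_upwards [hden.eventually_ne hβ', hM.eventually_gt_atTop 0] with N hN hMN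
  have hM' : (M N : ℂ) ≠ 0 := by exact_mod_cast hMN.ne'
  have h1 : (β : ℂ) - ((M N)⁻¹ * t : ℝ) * (1 : ℝ) * Complex.I = β - z N := by simp [hz]
  have h2 : (M N : ℂ) * z N = t * Complex.I := by
    simp only [hz]
    push_cast
    field_simp
  rw [h1]
  simp only [Complex.ofReal_zero, mul_zero, zero_mul, Complex.exp_zero, one_mul]
  rw [div_sub_one hN, sub_sub_cancel, ← mul_div_assoc, h2]

/-- The normalization makes the bias of the tail sums negligible. -/
lemma tendsto_sqrt_mul_bias {δ : ℕ → ℝ} (hδ_pos : ∀ N, 0 < δ N) (hδ : Tendsto δ atTop (𝓝 0))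
    {β x y : ℝ}
    (h : Tendsto (fun N : ℕ => (N : ℝ) * δ N ^ (β + 2 * min x y)) atTop (𝓝 0)) :
    Tendsto (fun N : ℕ => √(N * δ N ^ β) * (δ N ^ x + δ N ^ y)) atTop (𝓝 0) := by
  have h1 : Tendsto (fun N : ℕ => 2 * √((N : ℝ) * δ N ^ (β + 2 * min x y))) atTop (𝓝 0) := by
    have := (((Real.continuous_sqrt.tendsto 0).comp h).const_mul 2)
    simpa using this
  refine squeeze_zero' (Eventually.of_forall fun N => ?_) ?_ h1
  · have := hδ_pos N
    positivity
  · filter_upwards [hδ.eventually (Iic_mem_nhds zero_lt_one)] with N hN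
    have hp := hδ_pos N
    have e1 : δ N ^ (β + 2 * min x y) = δ N ^ β * (δ N ^ min x y) ^ 2 := by
      rw [Real.rpow_add hp, mul_comm 2, Real.rpow_mul hp.le]
      norm_num
    have e2 : √((N : ℝ) * δ N ^ (β + 2 * min x y)) = √(N * δ N ^ β) * δ N ^ min x y := by
      rw [e1, ← mul_assoc, Real.sqrt_mul (by positivity),
        Real.sqrt_sq (Real.rpow_nonneg hp.le _)]
    have e3 : δ N ^ x ≤ δ N ^ min x y := Real.rpow_le_rpow_of_exponent_ge hp hN (min_le_left _ _)
    have e4 : δ N ^ y ≤ δ N ^ min x y := Real.rpow_le_rpow_of_exponent_ge hp hN (min_le_right _ _)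
    rw [e2]
    calc √(N * δ N ^ β) * (δ N ^ x + δ N ^ y)
        ≤ √(N * δ N ^ β) * (δ N ^ min x y + δ N ^ min x y) := by gcongr
      _ = _ := by ring

section CleanLimits

variable {Ω : Type*} [MeasurableSpace Ω] {P : Measure Ω}
  {a : ℕ → Ω → ℝ} {G : ℝ → ℝ} {β ν κ : ℝ}

lemma AssumptionG.aemeasurable_sum_jumpAffine (hG : AssumptionG P a G β ν κ) (δ r c c₀ c₁ : ℝ)
    (N : ℕ) : AEMeasurable (fun ω =>
      c * ∑ i ∈ Finset.range N, jumpAffine c₀ c₁ (logExcess δ r (a i ω))) P := by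
  have hm := hG.measurable
  fun_prop

variable [IsProbabilityMeasure P] {r : ℝ} {δ : ℕ → ℝ}

/-- The central limit theorem for the noiseless sample. The limit law `𝒩(0, κ)` is written as that
of `κ / β` times a variable with law `𝒩(0, β² / κ)`. -/
lemma AssumptionG.tendstoInDistribution_numerator (hG : AssumptionG P a G β ν κ) (hr : 1 < r)
    (hδ_pos : ∀ N, 0 < δ N) (hδ : Tendsto δ atTop (𝓝 0))
    (hδ_large : Tendsto (fun N : ℕ => (N : ℝ) * δ N ^ β) atTop atTop)
    (hδ_small : Tendsto (fun N : ℕ => (N : ℝ) * δ N ^ (β + 2 * min ν ((r - 1) * β)))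
      atTop (𝓝 0)) :
    TendstoInDistribution
      (fun (N : ℕ) (ω : Ω) => (√((N : ℝ) * δ N ^ β))⁻¹ *
        ∑ i ∈ Finset.range N, jumpAffine 1 (-β) (logExcess (δ N) r (a i ω)))
      atTop (fun x : ℝ => κ / β * x) (fun _ => P) (gaussianReal 0 (β ^ 2 / κ).toNNReal) where
  forall_aemeasurable N := hG.aemeasurable_sum_jumpAffine _ _ _ _ _ _
  tendsto := by
    have hβ : 0 < β := by linarith [hG.one_lt_beta]
    have hκ := hG.kappa_pos
    refine ProbabilityMeasure.tendsto_iff_tendsto_charFun.2 fun t => ?_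
    have hs : Tendsto (fun N : ℕ => |(√((N : ℝ) * δ N ^ β))⁻¹ * t| * (N * δ N ^ β) *
        (δ N ^ ν + δ N ^ ((r - 1) * β))) atTop (𝓝 0) := by
      have := (tendsto_sqrt_mul_bias hδ_pos hδ hδ_small).const_mul |t|
      rw [mul_zero] at this
      refine this.congr' ?_
      filter_upwards [hδ_large.eventually_gt_atTop 0] with N hN
      have hsq := Real.mul_self_sqrt hN.le
      have hpos := Real.sqrt_pos.2 hN
      rw [abs_mul, abs_inv, abs_of_pos hpos]
      nth_rewrite 3 [← hsq]
      field_simp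
    have hmain := hG.tendsto_charFun_sum hr hδ_pos hδ 1 (-β) hs
      (tendsto_mul_charFun_one_sub_exponential hδ_large hβ t)
    simp only [ProbabilityMeasure.coe_mk]
    have hlim : charFun ((gaussianReal 0 (β ^ 2 / κ).toNNReal).map fun x : ℝ => κ / β * x) t =
        Complex.exp (κ * (-t ^ 2 / 2)) := by
      rw [charFun_map_mul, charFun_gaussianReal, Real.coe_toNNReal _ (by positivity)]
      congr 1
      have hβ' : (β : ℂ) ≠ 0 := by exact_mod_cast hβ.ne'
      have hκ' : (κ : ℂ) ≠ 0 := by exact_mod_cast hκ.ne'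
      push_cast
      field_simp
      ring
    rw [hlim]
    refine hmain.congr fun N => ?_
    have hm : AEMeasurable (fun ω =>
        ∑ i ∈ Finset.range N, jumpAffine 1 (-β) (logExcess (δ N) r (a i ω))) P := by
      simpa using hG.aemeasurable_sum_jumpAffine (δ N) r 1 1 (-β) N
    rw [charFun_map_mul_comp hm]

/-- The weak law of large numbers for the denominator, in distributional form. -/
lemma AssumptionG.tendstoInDistribution_denominator (hG : AssumptionG P a G β ν κ) (hr : 1 < r)
    (hδ_pos : ∀ N, 0 < δ N) (hδ : Tendsto δ atTop (𝓝 0))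
    (hδ_large : Tendsto (fun N : ℕ => (N : ℝ) * δ N ^ β) atTop atTop) :
    TendstoInDistribution
      (fun (N : ℕ) (ω : Ω) => ((N : ℝ) * δ N ^ β)⁻¹ *
        ∑ i ∈ Finset.range N, logExcess (δ N) r (a i ω))
      atTop (fun _ : Ω => κ / β) (fun _ => P) P where
  forall_aemeasurable N := by
    have hm := hG.measurable
    fun_prop
  tendsto := by
    have hβ : 0 < β := by linarith [hG.one_lt_beta]
    have hν := hG.nu_pos
    refine ProbabilityMeasure.tendsto_iff_tendsto_charFun.2 fun t => ?_
    have hpow : ∀ x : ℝ, 0 < x → Tendsto (fun N => δ N ^ x) atTop (𝓝 0) := by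
      intro x hx
      simpa [Real.zero_rpow hx.ne'] using hδ.rpow_const (Or.inr hx.le)
    have hs : Tendsto (fun N : ℕ => |((N : ℝ) * δ N ^ β)⁻¹ * t| * (N * δ N ^ β) *
        (δ N ^ ν + δ N ^ ((r - 1) * β))) atTop (𝓝 0) := by
      have := ((hpow ν hν).add (hpow ((r - 1) * β) (by nlinarith))).const_mul |t|
      rw [add_zero, mul_zero] at this
      refine this.congr' ?_
      filter_upwards [hδ_large.eventually_gt_atTop 0] with N hN
      rw [abs_mul, abs_inv, abs_of_pos hN, mul_right_comm _ |t|, inv_mul_cancel₀ hN.ne', one_mul]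
    have hmain := hG.tendsto_charFun_sum hr hδ_pos hδ 0 1 hs
      (tendsto_mul_charFun_exponential hδ_large hβ t)
    simp only [ProbabilityMeasure.coe_mk]
    have hlim : charFun (P.map fun _ => κ / β) t = Complex.exp (κ * (t * Complex.I / β)) := by
      rw [Measure.map_const, measure_univ, one_smul, charFun_dirac]
      congr 1
      simp
      ring
    rw [hlim]
    refine hmain.congr fun N => ?_
    have hm : AEMeasurable (fun ω =>
        ∑ i ∈ Finset.range N, logExcess (δ N) r (a i ω)) P := by
      have hm := hG.measurable
      fun_prop
    rw [charFun_map_mul_comp hm]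
    simp [jumpAffine]

end CleanLimits

/-- Convergence in distribution to a constant implies convergence in probability. -/
lemma TendstoInDistribution.tendstoInMeasure_const {Ω : Type*} [MeasurableSpace Ω]
    {P : Measure Ω} [IsProbabilityMeasure P] {X : ℕ → Ω → ℝ} {c : ℝ}
    (h : TendstoInDistribution X atTop (fun _ : Ω => c) (fun _ => P) P) :
    TendstoInMeasure P X atTop fun _ => c := by
  rw [tendstoInMeasure_iff_norm]
  intro ε hε
  have hF : IsClosed {x : ℝ | ε ≤ ‖x - c‖} := isClosed_le (by fun_prop) (by fun_prop)
  have h1 := ProbabilityMeasure.limsup_measure_closed_le_of_tendsto h.tendsto hF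
  simp only [ProbabilityMeasure.coe_mk] at h1
  have h2 : (P.map fun _ => c) {x : ℝ | ε ≤ ‖x - c‖} = 0 := by
    rw [Measure.map_const, measure_univ, one_smul, Measure.dirac_apply' _ hF.measurableSet]
    simp [hε]
  rw [h2] at h1
  have h3 : ∀ n, P.map (X n) {x : ℝ | ε ≤ ‖x - c‖} = P {ω | ε ≤ ‖X n ω - c‖} := fun n =>
    Measure.map_apply_of_aemeasurable (h.forall_aemeasurable n) hF.measurableSet
  simp only [h3] at h1
  exact tendsto_of_le_liminf_of_limsup_le bot_le h1

/-! ### Effect of the noise -/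

section Noise

variable {Ω : Type*} [MeasurableSpace Ω] {P : Measure Ω} [IsProbabilityMeasure P]

lemma abs_jumpAffine_sub_le (c₀ c₁ y y' : ℝ) :
    |jumpAffine c₀ c₁ y - jumpAffine c₀ c₁ y'| ≤
      |c₀| * {z : ℝ × ℝ | ¬(0 < z.1 ↔ 0 < z.2)}.indicator 1 (y, y') + |c₁| * |y - y'| := by
  have h : jumpAffine c₀ c₁ y - jumpAffine c₀ c₁ y' =
      ((if 0 < y then c₀ else 0) - (if 0 < y' then c₀ else 0)) + c₁ * (y - y') := by
    unfold jumpAffine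
    ring
  rw [h, ← abs_mul c₁]
  refine (abs_add_le _ _).trans (add_le_add_left ?_ _)
  by_cases h1 : 0 < y <;> by_cases h2 : 0 < y' <;> simp [h1, h2]

lemma integral_abs_jumpAffine_sub_le {Y Y' : Ω → ℝ} {L B : ℝ} (hL : 0 < L)
    (hY : Measurable Y) (hY' : Measurable Y')
    (hYL : ∀ ω, Y ω ∈ Set.Icc 0 L) (hYL' : ∀ ω, Y' ω ∈ Set.Icc 0 L)
    (hB : ∀ t ∈ Set.Ico 0 L, P.real {ω | ¬(t < Y ω ↔ t < Y' ω)} ≤ B) (c₀ c₁ : ℝ) :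
    Integrable (fun ω => |jumpAffine c₀ c₁ (Y ω) - jumpAffine c₀ c₁ (Y' ω)|) P ∧
    ∫ ω, |jumpAffine c₀ c₁ (Y ω) - jumpAffine c₀ c₁ (Y' ω)| ∂P ≤ (|c₀| + |c₁| * L) * B := by
  set A : Set Ω := {ω | ¬(0 < Y ω ↔ 0 < Y' ω)} with hAdef
  have hA : MeasurableSet A :=
    ((measurableSet_lt measurable_const hY).iff (measurableSet_lt measurable_const hY')).compl
  have hi1 : Integrable (fun ω => |c₀| * A.indicator (1 : Ω → ℝ) ω) P :=
    ((integrable_const (1 : ℝ)).indicator hA).const_mul _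
  have hi2 : Integrable (fun ω => |c₁| * |Y ω - Y' ω|) P := by
    refine Integrable.of_bound (by fun_prop) (|c₁| * L) (ae_of_all _ fun ω => ?_)
    have h1 := hYL ω
    have h2 := hYL' ω
    have : |Y ω - Y' ω| ≤ L := abs_le.2 ⟨by linarith [h1.1, h2.2], by linarith [h1.2, h2.1]⟩
    simp only [norm_mul, Real.norm_eq_abs, abs_abs]
    gcongr
  have hpt : ∀ ω, |jumpAffine c₀ c₁ (Y ω) - jumpAffine c₀ c₁ (Y' ω)| ≤
      |c₀| * A.indicator (1 : Ω → ℝ) ω + |c₁| * |Y ω - Y' ω| := fun ω =>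
    abs_jumpAffine_sub_le c₀ c₁ (Y ω) (Y' ω)
  have hi : Integrable (fun ω => |jumpAffine c₀ c₁ (Y ω) - jumpAffine c₀ c₁ (Y' ω)|) P := by
    refine Integrable.mono' (hi1.add hi2) (by fun_prop) (ae_of_all _ fun ω => ?_)
    simpa using hpt ω
  refine ⟨hi, ?_⟩
  have h0 : P.real A ≤ B := hB 0 ⟨le_rfl, hL⟩
  calc ∫ ω, |jumpAffine c₀ c₁ (Y ω) - jumpAffine c₀ c₁ (Y' ω)| ∂P
      ≤ ∫ ω, (|c₀| * A.indicator (1 : Ω → ℝ) ω + |c₁| * |Y ω - Y' ω|) ∂P :=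
        integral_mono hi (hi1.add hi2) hpt
    _ = |c₀| * P.real A + |c₁| * ∫ ω, |Y ω - Y' ω| ∂P := by
        rw [integral_add hi1 hi2, integral_const_mul, integral_const_mul, integral_indicator_one hA]
    _ ≤ |c₀| * B + |c₁| * (L * B) := by
        gcongr
        exact integral_abs_sub_le hL.le hY hY' hYL hYL' hB
    _ = _ := by ring

variable {a : ℕ → Ω → ℝ} {G : ℝ → ℝ} {β ν κ : ℝ}

/-- A perturbation `ρ` moves an observation across the level `1 - v` only if `|ρ|` exceeds `η δ` or
the observation lies within `η δ` of the level; the latter has probability of order `η δ ^ β`. -/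
lemma AssumptionG.exists_crossing_bound (hG : AssumptionG P a G β ν κ) :
    ∃ u₀ ∈ Set.Ioo (0 : ℝ) 1, ∃ C : ℝ, 0 ≤ C ∧ ∀ δ η : ℝ, 0 < δ → 3 * δ ≤ u₀ → 0 < η → η ≤ 1 →
      ∀ (i : ℕ) (ρ : Ω → ℝ), ∀ v ∈ Set.Ioc 0 δ,
        P.real {ω | ¬(1 - v < a i ω ↔ 1 - v < a i ω + ρ ω)} ≤
          P.real {ω | η * δ < |ρ ω|} + C * (η * δ ^ β) := by
  obtain ⟨u₀, hu₀, C, hC, -, hinc⟩ := hG.exists_tail_bounds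
  have hβ := hG.one_lt_beta
  refine ⟨u₀, hu₀, C * 3 ^ (β - 1) * 3, by positivity, ?_⟩
  intro δ η hδ hδu hη hη1 i ρ v hv
  have hηδ : 0 < η * δ := mul_pos hη hδ
  have hηδ' : η * δ ≤ δ := mul_le_of_le_one_left hδ.le hη1
  set w := v + 2 * (η * δ)
  set v' := max (v - η * δ) 0
  have hv' : 0 ≤ v' := le_max_right _ _
  have hvw : v' ≤ w := max_le (by simp only [w]; linarith) (by linarith [hv.1])
  have hw3 : w ≤ 3 * δ := by linarith [hv.2]
  have hw0 : 0 < w := by linarith [hv.1]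
  set S : Set Ω := {ω | 1 - w < a i ω} \ {ω | 1 - v' < a i ω} with hS
  have hsub : {ω | ¬(1 - v < a i ω ↔ 1 - v < a i ω + ρ ω)} ≤ᵐ[P]
      ({ω | η * δ < |ρ ω|} ∪ S : Set Ω) := by
    filter_upwards [hG.mem_Ioo i] with ω hω hflip
    by_cases hρ : η * δ < |ρ ω|
    · exact Or.inl hρ
    · right
      have h1 := abs_le.1 (not_lt.1 hρ)
      have h2 : 1 - w < a i ω ∧ a i ω ≤ 1 - (v - η * δ) := by
        by_cases h3 : 1 - v < a i ω
        · have h4 : ¬ 1 - v < a i ω + ρ ω := fun h => hflip (iff_of_true h3 h)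
          exact ⟨by linarith, by linarith [not_lt.1 h4]⟩
        · have h4 : 1 - v < a i ω + ρ ω := by
            by_contra h
            exact hflip (iff_of_false h3 h)
          exact ⟨by linarith, by linarith [not_lt.1 h3]⟩
      refine ⟨h2.1, fun h5 => ?_⟩
      have h5' : 1 - v' < a i ω := h5
      rcases max_choice (v - η * δ) 0 with h6 | h6
      · rw [show v' = v - η * δ from h6] at h5'
        linarith [h2.2]
      · rw [show v' = 0 from h6] at h5'
        linarith [hω.2]
  have hSle : P.real S ≤ C * 3 ^ (β - 1) * 3 * (η * δ ^ β) := by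
    rw [hS, measureReal_sdiff (fun ω hω => ?_)
      (measurableSet_lt measurable_const (hG.measurable i)),
      hG.measureReal_lt i ⟨by linarith [hu₀.2], by linarith⟩,
      hG.measureReal_lt i ⟨by linarith [hu₀.2], by linarith⟩]
    · have h1 := hinc v' w hv' hvw (hw3.trans hδu)
      have h2 : w - v' ≤ 3 * (η * δ) := by
        have := le_max_left (v - η * δ) 0
        simp only [w, v']
        linarith
      have h3 : w ^ (β - 1) ≤ 3 ^ (β - 1) * δ ^ (β - 1) := by
        rw [← Real.mul_rpow (by norm_num) hδ.le]
        exact Real.rpow_le_rpow hw0.le hw3 (by linarith)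
      have h4 : δ ^ (β - 1) * δ = δ ^ β := by
        rw [Real.rpow_sub_one hδ.ne']
        field_simp
      have h5 := sub_nonneg.2 hvw
      have h6 : 0 ≤ δ ^ (β - 1) := Real.rpow_nonneg hδ.le _
      calc _ ≤ C * w ^ (β - 1) * (w - v') := h1
        _ ≤ C * (3 ^ (β - 1) * δ ^ (β - 1)) * (3 * (η * δ)) := by gcongr
        _ = _ := by
          rw [← h4]
          ring
    · have hω' : 1 - v' < a i ω := hω
      exact lt_of_le_of_lt (by linarith) hω'
  calc P.real {ω | ¬(1 - v < a i ω ↔ 1 - v < a i ω + ρ ω)}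
      ≤ P.real ({ω | η * δ < |ρ ω|} ∪ S) :=
        ENNReal.toReal_mono (measure_ne_top _ _) (measure_mono_ae hsub)
    _ ≤ P.real {ω | η * δ < |ρ ω|} + P.real S := measureReal_union_le _ _
    _ ≤ _ := by gcongr

lemma tendstoInMeasure_zero_of_integral_abs {f : ℕ → Ω → ℝ} {b : ℕ → ℝ}
    (hb : Tendsto b atTop (𝓝 0))
    (hf : ∀ᶠ N in atTop, Integrable (fun ω => |f N ω|) P ∧ ∫ ω, |f N ω| ∂P ≤ b N) :
    TendstoInMeasure P f atTop 0 := by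
  rw [tendstoInMeasure_iff_measureReal_norm]
  intro ε hε
  have hb' : Tendsto (fun N => b N / ε) atTop (𝓝 0) := by simpa using hb.div_const ε
  refine squeeze_zero' (Eventually.of_forall fun _ => measureReal_nonneg) ?_ hb'
  filter_upwards [hf] with N hN
  have h1 := mul_meas_ge_le_integral_of_nonneg (ae_of_all _ fun ω => abs_nonneg (f N ω)) hN.1 ε
  rw [le_div_iff₀ hε, mul_comm]
  simpa using h1.trans hN.2

/-- The noise is negligible in a normalized tail sum as soon as, at some relative scale `η N`, the
large values of the noise have probability `O(η δ ^ β)` and `η |log δ|` times the total weight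
`|c| N δ ^ β` of the exceedances vanishes. -/
lemma AssumptionG.tendstoInMeasure_noise (hG : AssumptionG P a G β ν κ) {r : ℝ} (hr : 1 < r)
    {δ : ℕ → ℝ} (hδ_pos : ∀ N, 0 < δ N) (hδ : Tendsto δ atTop (𝓝 0))
    {ρ : ℕ → ℕ → Ω → ℝ} (hρ : ∀ N, ∀ i < N, Measurable (ρ N i)) {η c : ℕ → ℝ}
    (hη : ∀ᶠ N in atTop, η N ∈ Set.Ioc (0 : ℝ) 1)
    (hηρ : ∀ᶠ N in atTop, ∀ i < N,
      P.real {ω | η N * δ N < |ρ N i ω|} ≤ 2 * (η N * δ N ^ β))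
    (hc : Tendsto (fun N : ℕ => |c N| * (N * δ N ^ β) * |Real.log (δ N)| * η N) atTop (𝓝 0))
    (c₀ c₁ : ℝ) :
    TendstoInMeasure P (fun (N : ℕ) (ω : Ω) =>
      c N * ∑ i ∈ Finset.range N, jumpAffine c₀ c₁ (logExcess (δ N) r (a i ω + ρ N i ω)) -
      c N * ∑ i ∈ Finset.range N, jumpAffine c₀ c₁ (logExcess (δ N) r (a i ω))) atTop 0 := by
  obtain ⟨u₀, hu₀, C, hC, hcross⟩ := hG.exists_crossing_bound
  have hlim := hc.const_mul ((|c₀| + |c₁| * (r - 1)) * (2 + C))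
  rw [mul_zero] at hlim
  refine tendstoInMeasure_zero_of_integral_abs hlim ?_
  have hsmall : ∀ᶠ N in atTop, δ N ≤ u₀ / 3 :=
    hδ.eventually (Iic_mem_nhds (by linarith [hu₀.1]))
  have hlog : ∀ᶠ N in atTop, δ N ≤ Real.exp (-1) :=
    hδ.eventually (Iic_mem_nhds (Real.exp_pos _))
  filter_upwards [hη, hηρ, hsmall, hlog] with N hη hηρ hsmall hlog
  have hp := hδ_pos N
  have hδ1 : δ N < 1 := by linarith [hu₀.2]
  have hlog1 : 1 ≤ -Real.log (δ N) := by
    have := Real.log_le_log hp hlog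
    rw [Real.log_exp] at this
    linarith
  have hlogabs : |Real.log (δ N)| = -Real.log (δ N) := abs_of_nonpos (by linarith)
  set L := (r - 1) * -Real.log (δ N) with hLdef
  have hL : 0 < L := mul_pos (by linarith) (by linarith)
  set B := (2 + C) * (η N * δ N ^ β) with hBdef
  have hηβ : 0 ≤ η N * δ N ^ β := mul_nonneg hη.1.le (Real.rpow_nonneg hp.le _)
  have hterm : ∀ i ∈ Finset.range N,
      Integrable (fun ω => |jumpAffine c₀ c₁ (logExcess (δ N) r (a i ω + ρ N i ω)) -
        jumpAffine c₀ c₁ (logExcess (δ N) r (a i ω))|) P ∧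
      ∫ ω, |jumpAffine c₀ c₁ (logExcess (δ N) r (a i ω + ρ N i ω)) -
        jumpAffine c₀ c₁ (logExcess (δ N) r (a i ω))| ∂P ≤ (|c₀| + |c₁| * L) * B := by
    intro i hi
    have hma := hG.measurable i
    have hmρ := hρ N i (Finset.mem_range.1 hi)
    refine integral_abs_jumpAffine_sub_le hL (by fun_prop) (by fun_prop)
      (fun ω => logExcess_mem_Icc hp hδ1 hr _) (fun ω => logExcess_mem_Icc hp hδ1 hr _) ?_ c₀ c₁
    intro t ht
    have h1 : Real.exp (-t) ≤ 1 := Real.exp_le_one_iff.2 (by linarith [ht.1])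
    have h2 := hcross (δ N) (η N) hp (by linarith) hη.1 hη.2 i (ρ N i) (δ N * Real.exp (-t))
      ⟨mul_pos hp (Real.exp_pos _), by nlinarith⟩
    have h3 := hηρ i (Finset.mem_range.1 hi)
    simp only [lt_logExcess_iff hp hδ1 hr _ ht]
    simp only [iff_comm (a := 1 - δ N * Real.exp (-t) < a i _)] at h2
    refine h2.trans ?_
    rw [hBdef]
    linarith
  have hpt : ∀ ω, |c N * ∑ i ∈ Finset.range N,
        jumpAffine c₀ c₁ (logExcess (δ N) r (a i ω + ρ N i ω)) -
      c N * ∑ i ∈ Finset.range N, jumpAffine c₀ c₁ (logExcess (δ N) r (a i ω))| ≤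
      |c N| * ∑ i ∈ Finset.range N, |jumpAffine c₀ c₁ (logExcess (δ N) r (a i ω + ρ N i ω)) -
        jumpAffine c₀ c₁ (logExcess (δ N) r (a i ω))| := by
    intro ω
    rw [← mul_sub, ← Finset.sum_sub_distrib, abs_mul]
    gcongr
    exact Finset.abs_sum_le_sum_abs _ _
  have hisum := (integrable_finsetSum (Finset.range N) fun i hi => (hterm i hi).1).const_mul |c N|
  have hmeas : AEStronglyMeasurable (fun ω => |c N * ∑ i ∈ Finset.range N,
        jumpAffine c₀ c₁ (logExcess (δ N) r (a i ω + ρ N i ω)) -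
      c N * ∑ i ∈ Finset.range N, jumpAffine c₀ c₁ (logExcess (δ N) r (a i ω))|) P := by
    have hma := hG.measurable
    have h1 : Measurable fun ω => ∑ i ∈ Finset.range N,
        jumpAffine c₀ c₁ (logExcess (δ N) r (a i ω + ρ N i ω)) :=
      Finset.measurable_fun_sum _ fun i hi => by
        have hmρ := hρ N i (Finset.mem_range.1 hi)
        fun_prop
    have h2 : Measurable fun ω => ∑ i ∈ Finset.range N,
        jumpAffine c₀ c₁ (logExcess (δ N) r (a i ω)) := by fun_prop
    exact ((h1.const_mul _).sub (h2.const_mul _)).abs.aestronglyMeasurable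
  have hint := hisum.mono' hmeas (ae_of_all _ fun ω => by simpa using hpt ω)
  refine ⟨hint, (integral_mono hint hisum hpt).trans ?_⟩
  rw [integral_const_mul, integral_finsetSum _ fun i hi => (hterm i hi).1]
  have hLc : |c₀| + |c₁| * L ≤ (|c₀| + |c₁| * (r - 1)) * |Real.log (δ N)| := by
    rw [hlogabs, hLdef]
    nlinarith [abs_nonneg c₀]
  calc |c N| * ∑ i ∈ Finset.range N,
        ∫ ω, |jumpAffine c₀ c₁ (logExcess (δ N) r (a i ω + ρ N i ω)) -
          jumpAffine c₀ c₁ (logExcess (δ N) r (a i ω))| ∂P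
      ≤ |c N| * ∑ _i ∈ Finset.range N, (|c₀| + |c₁| * L) * B := by
        gcongr with i hi
        exact (hterm i hi).2
    _ = |c N| * (N * ((|c₀| + |c₁| * L) * B)) := by simp
    _ ≤ |c N| * (N * (((|c₀| + |c₁| * (r - 1)) * |Real.log (δ N)|) * B)) := by
        have : 0 ≤ B := mul_nonneg (by linarith) hηβ
        gcongr
    _ = _ := by
        rw [hBdef]
        ring

end Noise

/-! ### Asymptotic normality of the noisy estimator -/

/-- A bound `χ / ε ^ p + χ'` on a probability forces `χ ≥ 0`: let `ε → 0`. -/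
lemma nonneg_of_forall_nonneg_div_rpow_add {p x y : ℝ} (hp : 1 ≤ p)
    (h : ∀ ε ∈ Set.Ioo (0 : ℝ) 1, 0 ≤ x / ε ^ p + y) : 0 ≤ x := by
  have hlim : Tendsto (fun ε : ℝ => x + y * ε ^ p) (𝓝[>] 0) (𝓝 x) := by
    have h1 : Tendsto (fun ε : ℝ => ε ^ p) (𝓝 0) (𝓝 0) := by
      have := (Real.continuous_rpow_const (q := p) (by linarith)).tendsto 0
      rwa [Real.zero_rpow (by linarith)] at this
    simpa using ((h1.const_mul y).const_add x).mono_left nhdsWithin_le_nhds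
  refine ge_of_tendsto hlim ?_
  filter_upwards [Ioo_mem_nhdsGT (zero_lt_one (α := ℝ))] with ε hε
  have hpos : 0 < ε ^ p := Real.rpow_pos_of_pos hε.1 p
  have h1 := mul_nonneg (h ε hε) hpos.le
  rwa [add_mul, div_mul_cancel₀ _ hpos.ne'] at h1

/-- The relative scale `η` of the noise: the maximum in the rate condition, increased by a
negligible positive amount so that it does not vanish. It balances `χ / (η δ) ^ p` against the
probability `η δ ^ β` of an observation falling within `η δ` of a level. -/
lemma exists_noise_scale {Ω : Type*} [MeasurableSpace Ω] {P : Measure Ω}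
    {ρ : ℕ → ℕ → Ω → ℝ} {β p : ℝ} (hp : 1 ≤ p)
    {δ χ χ' : ℕ → ℝ} (hδ_pos : ∀ N, 0 < δ N) (hδ : Tendsto δ atTop (𝓝 0))
    (hδ_large : Tendsto (fun N : ℕ => (N : ℝ) * δ N ^ β) atTop atTop)
    (hbound : ∀ N, ∀ i < N, ∀ ε ∈ Set.Ioo (0 : ℝ) 1,
      P.real {ω | ε < |ρ N i ω|} ≤ χ N / ε ^ p + χ' N)
    (hrate : Tendsto (fun N : ℕ => √((N : ℝ) * δ N ^ β) *
        max (χ' N / δ N ^ β) ((χ N / δ N ^ (p + β)) ^ (1 / (p + 1))) * Real.log (δ N))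
      atTop (𝓝 0)) :
    ∃ η : ℕ → ℝ, (∀ᶠ N in atTop, η N ∈ Set.Ioc (0 : ℝ) 1) ∧
      (∀ᶠ N in atTop, ∀ i < N,
        P.real {ω | η N * δ N < |ρ N i ω|} ≤ 2 * (η N * δ N ^ β)) ∧
      Tendsto (fun N : ℕ => √((N : ℝ) * δ N ^ β) * |Real.log (δ N)| * η N) atTop (𝓝 0) := by
  set M : ℕ → ℝ := fun N => (N : ℝ) * δ N ^ β with hM
  set m : ℕ → ℝ := fun N =>
    max (χ' N / δ N ^ β) ((χ N / δ N ^ (p + β)) ^ (1 / (p + 1))) with hm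
  set η : ℕ → ℝ := fun N => |m N| + (M N * (1 + |Real.log (δ N)|))⁻¹ with hη
  have hlarge : ∀ᶠ N in atTop, 1 ≤ M N := hδ_large.eventually_ge_atTop 1
  have hlog : ∀ᶠ N in atTop, δ N ≤ Real.exp (-1) :=
    hδ.eventually (Iic_mem_nhds (Real.exp_pos _))
  have hlim : Tendsto (fun N : ℕ => √(M N) * |Real.log (δ N)| * η N) atTop (𝓝 0) := by
    have h1 := hrate.abs
    rw [abs_zero] at h1
    have h2 : Tendsto (fun N => (√(M N))⁻¹) atTop (𝓝 0) :=
      tendsto_inv_atTop_zero.comp (Real.tendsto_sqrt_atTop.comp hδ_large)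
    have h3 := h1.add h2
    rw [add_zero] at h3
    refine squeeze_zero' (Eventually.of_forall fun N => ?_) ?_ h3
    · have := hδ_pos N
      positivity
    · filter_upwards [hlarge] with N hN
      have hN0 : 0 < M N := by linarith
      have hs := Real.sqrt_pos.2 hN0
      have hss := Real.mul_self_sqrt hN0.le
      have h4 : √(M N) * |Real.log (δ N)| * |m N| = |√(M N) * m N * Real.log (δ N)| := by
        rw [abs_mul, abs_mul, abs_of_pos hs]
        ring
      have h5 : √(M N) * |Real.log (δ N)| * (M N * (1 + |Real.log (δ N)|))⁻¹ ≤ (√(M N))⁻¹ := by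
        have h6 : |Real.log (δ N)| * (1 + |Real.log (δ N)|)⁻¹ ≤ 1 := by
          rw [← div_eq_mul_inv]
          exact div_le_one_of_le₀ (by linarith) (by positivity)
        have h7 : √(M N) * (M N)⁻¹ = (√(M N))⁻¹ := by
          nth_rewrite 2 [← hss]
          field_simp
        rw [mul_inv]
        calc √(M N) * |Real.log (δ N)| * ((M N)⁻¹ * (1 + |Real.log (δ N)|)⁻¹)
            = (√(M N) * (M N)⁻¹) * (|Real.log (δ N)| * (1 + |Real.log (δ N)|)⁻¹) := by ring
          _ ≤ (√(M N) * (M N)⁻¹) * 1 := by gcongr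
          _ = _ := by rw [mul_one, h7]
      simp only [hη, mul_add]
      exact add_le_add h4.le (by simpa only [mul_add] using h5)
  have hη01 : ∀ᶠ N in atTop, η N ∈ Set.Ioc (0 : ℝ) 1 := by
    filter_upwards [hlarge, hlog, hlim.eventually (Iic_mem_nhds zero_lt_one)] with N hN hl h1
    have hp := hδ_pos N
    have hlog1 : 1 ≤ |Real.log (δ N)| := by
      have := Real.log_le_log hp hl
      rw [Real.log_exp] at this
      exact le_abs.2 (Or.inr (by linarith))
    have hη0 : 0 < η N := by
      have : 0 < M N := by linarith
      simp only [hη]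
      positivity
    refine ⟨hη0, le_trans ?_ h1⟩
    exact le_mul_of_one_le_left hη0.le
      (one_le_mul_of_one_le_of_one_le (Real.one_le_sqrt.2 hN) hlog1)
  refine ⟨η, hη01, ?_, hlim⟩
  filter_upwards [hη01, hlarge, hδ.eventually (Iio_mem_nhds zero_lt_one)] with N hηN hN hδ1 i hi
  have hd := hδ_pos N
  have hχ : 0 ≤ χ N := nonneg_of_forall_nonneg_div_rpow_add hp fun ε hε =>
    measureReal_nonneg.trans (hbound N i hi ε hε)
  have hmη : m N ≤ η N := by
    have : 0 < M N := by linarith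
    have : 0 ≤ (M N * (1 + |Real.log (δ N)|))⁻¹ := by positivity
    simp only [hη]
    linarith [le_abs_self (m N)]
  have hδβ : 0 < δ N ^ β := Real.rpow_pos_of_pos hd _
  have hδp : 0 < δ N ^ p := Real.rpow_pos_of_pos hd _
  have hηp : 0 < η N ^ p := Real.rpow_pos_of_pos hηN.1 _
  have h1 := hbound N i hi (η N * δ N)
    ⟨mul_pos hηN.1 hd, mul_lt_one_of_nonneg_of_lt_one_right hηN.2 hd.le hδ1⟩
  have h2 : χ' N ≤ η N * δ N ^ β := (div_le_iff₀ hδβ).1 ((le_max_left _ _).trans hmη)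
  have h3 : χ N / (η N * δ N) ^ p ≤ η N * δ N ^ β := by
    have hq0 : 0 ≤ χ N / δ N ^ (p + β) := div_nonneg hχ (Real.rpow_nonneg hd.le _)
    have hq : χ N / δ N ^ (p + β) ≤ η N ^ (p + 1) := by
      have h4 : (χ N / δ N ^ (p + β)) ^ (1 / (p + 1)) ≤ η N := (le_max_right _ _).trans hmη
      have h5 := Real.rpow_le_rpow (Real.rpow_nonneg hq0 _) h4 (by linarith : 0 ≤ p + 1)
      rwa [← Real.rpow_mul hq0, one_div_mul_cancel (by linarith), Real.rpow_one] at h5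
    rw [div_le_iff₀ (Real.rpow_pos_of_pos hd _), Real.rpow_add hd, Real.rpow_add hηN.1,
      Real.rpow_one] at hq
    rw [Real.mul_rpow hηN.1.le hd.le, div_le_iff₀ (by positivity)]
    linarith
  linarith

theorem theorem2 {Ω : Type*} [MeasurableSpace Ω] (P : Measure Ω) [IsProbabilityMeasure P]
    (a : ℕ → Ω → ℝ) (G : ℝ → ℝ) (β ν κ : ℝ) (hG : AssumptionG P a G β ν κ)
    (ρ : ℕ → ℕ → Ω → ℝ) (hρ : ∀ N, ∀ i < N, Measurable (ρ N i))
    (r : ℝ) (hr : 1 < r)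
    (δ : ℕ → ℝ) (hδ_pos : ∀ N, 0 < δ N) (hδ : Tendsto δ atTop (𝓝 0))
    (hδ_large : Tendsto (fun N : ℕ => (N : ℝ) * δ N ^ β) atTop atTop)
    (hδ_small : Tendsto (fun N : ℕ => (N : ℝ) * δ N ^ (β + 2 * min ν ((r - 1) * β)))
      atTop (𝓝 0))
    (p : ℝ) (hp : 1 ≤ p)
    (χ χ' : ℕ → ℝ) (hχ : Tendsto χ atTop (𝓝 0)) (hχ' : Tendsto χ' atTop (𝓝 0))
    (hbound : ∀ N, ∀ i < N, ∀ ε ∈ Set.Ioo (0 : ℝ) 1,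
      P.real {ω | ε < |ρ N i ω|} ≤ χ N / ε ^ p + χ' N)
    (hrate : Tendsto (fun N : ℕ => √((N : ℝ) * δ N ^ β) *
        max (χ' N / δ N ^ β) ((χ N / δ N ^ (p + β)) ^ (1 / (p + 1))) * Real.log (δ N))
      atTop (𝓝 0)) :
    TendstoInDistribution
      (fun (N : ℕ) (ω : Ω) => √((N : ℝ) * δ N ^ β) *
        (noisyTailEstimator N (δ N) r (fun i => a i ω + ρ N i ω) - β))
      atTop (id : ℝ → ℝ) (fun _ => P) (gaussianReal 0 (β ^ 2 / κ).toNNReal) := by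
  have hβ : 0 < β := by linarith [hG.one_lt_beta]
  have hκ := hG.kappa_pos
  have hma := hG.measurable
  obtain ⟨η, hη, hηρ, hηlim⟩ := exists_noise_scale hp hδ_pos hδ hδ_large hbound hrate
  set M : ℕ → ℝ := fun N => (N : ℝ) * δ N ^ β with hM
  set S : ℕ → Ω → ℝ := fun N ω => (√(M N))⁻¹ *
    ∑ i ∈ Finset.range N, jumpAffine 1 (-β) (logExcess (δ N) r (a i ω + ρ N i ω)) with hS
  set D : ℕ → Ω → ℝ := fun N ω => (M N)⁻¹ *
    ∑ i ∈ Finset.range N, logExcess (δ N) r (a i ω + ρ N i ω) with hD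
  have hpos : ∀ᶠ N in atTop, 1 ≤ M N := hδ_large.eventually_ge_atTop 1
  have hsum : ∀ (N : ℕ) (f : ℝ → ℝ), Measurable f →
      Measurable fun ω => ∑ i ∈ Finset.range N, f (a i ω + ρ N i ω) := fun N f hf =>
    Finset.measurable_fun_sum _ fun i hi =>
      hf.comp ((hma i).add (hρ N i (Finset.mem_range.1 hi)))
  have hSm : ∀ N, AEMeasurable (S N) P := fun N =>
    ((hsum N (fun y => jumpAffine 1 (-β) (logExcess (δ N) r y)) (by fun_prop)).const_mul
      _).aemeasurable
  have hDm : ∀ N, AEMeasurable (D N) P := fun N =>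
    ((hsum N (logExcess (δ N) r) (by fun_prop)).const_mul _).aemeasurable
  have hnoiseS : TendstoInMeasure P (S - fun (N : ℕ) (ω : Ω) => (√(M N))⁻¹ *
      ∑ i ∈ Finset.range N, jumpAffine 1 (-β) (logExcess (δ N) r (a i ω))) atTop 0 := by
    refine hG.tendstoInMeasure_noise hr hδ_pos hδ hρ hη hηρ ?_ 1 (-β)
    refine hηlim.congr' ?_
    filter_upwards [hpos] with N hN
    have hN0 : 0 < M N := by linarith
    have hs := Real.sqrt_pos.2 hN0
    have h1 : |(√(M N))⁻¹| * M N = √(M N) := by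
      rw [abs_of_pos (inv_pos.2 hs)]
      nth_rewrite 2 [← Real.mul_self_sqrt hN0.le]
      field_simp
    rw [h1]
  have hnoiseD : TendstoInMeasure P (D - fun (N : ℕ) (ω : Ω) => (M N)⁻¹ *
      ∑ i ∈ Finset.range N, logExcess (δ N) r (a i ω)) atTop 0 := by
    have h := hG.tendstoInMeasure_noise hr hδ_pos hδ hρ hη hηρ (c := fun N => (M N)⁻¹) ?_ 0 1
    · simpa only [jumpAffine, ite_self, one_mul, zero_add] using! h
    refine squeeze_zero' ?_ ?_ hηlim
    · filter_upwards [hη, hpos] with N hN hN1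
      have h1 := hN.1
      positivity
    · filter_upwards [hη, hpos] with N hN hN1
      have hN0 : 0 < M N := by linarith
      have h1 : |(M N)⁻¹| * M N ≤ √(M N) := by
        rw [abs_of_pos (inv_pos.2 hN0), inv_mul_cancel₀ hN0.ne']
        exact Real.one_le_sqrt.2 hN1
      have h2 := hN.1.le
      gcongr
  have hSlim := tendstoInDistribution_of_tendstoInMeasure_sub S _
    (hG.tendstoInDistribution_numerator hr hδ_pos hδ hδ_large hδ_small) hnoiseS hSm
  have hDlim := TendstoInDistribution.tendstoInMeasure_const
    (tendstoInDistribution_of_tendstoInMeasure_sub D _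
      (hG.tendstoInDistribution_denominator hr hδ_pos hδ hδ_large) hnoiseD hDm)
  have hc : 0 < κ / β := div_pos hκ hβ
  -- Division is not continuous at `0`, so the denominator is bounded below by half its limit.
  have hg : Continuous fun z : ℝ × ℝ => z.1 / max z.2 (κ / β / 2) :=
    continuous_fst.div (continuous_snd.max continuous_const) fun z =>
      (lt_max_of_lt_right (half_pos hc)).ne'
  have hV := hSlim.continuous_comp_prodMk_of_tendstoInMeasure_const hg hDlim hDm
  have hid : (fun x : ℝ => κ / β * x / max (κ / β) (κ / β / 2)) = id := by
    ext x
    rw [max_eq_left (by linarith)]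
    simp only [id]
    field_simp
  simp only [hid] at hV
  have hZm : ∀ N, AEMeasurable (fun ω => √(M N) *
      (noisyTailEstimator N (δ N) r (fun i => a i ω + ρ N i ω) - β)) P := by
    intro N
    simp only [noisyTailEstimator_eq_div (hδ_pos N)]
    have h1 := hsum N (fun y => if 0 < logExcess (δ N) r y then (1 : ℝ) else 0)
      (Measurable.ite (measurableSet_lt measurable_const (by fun_prop))
        measurable_const measurable_const)
    have h2 := hsum N (logExcess (δ N) r) (by fun_prop)
    exact (((h1.div h2).sub_const β).const_mul _).aemeasurable
  refine tendstoInDistribution_of_tendstoInMeasure_sub _ _ hV ?_ hZm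
  rw [tendstoInMeasure_iff_measureReal_norm] at hDlim ⊢
  intro ε hε
  refine squeeze_zero' (Eventually.of_forall fun _ => measureReal_nonneg) ?_
    (hDlim (κ / β / 2) (half_pos hc))
  filter_upwards [hpos] with N hN
  have hN0 : 0 < M N := by linarith
  -- Where `D` is within `κ / (2 β)` of its limit the lower bound is inactive, and the estimator
  -- minus `β`, times `√M`, equals `S / D` exactly.
  refine measureReal_mono fun ω hω => ?_
  by_contra hlt
  have h1 : |D N ω - κ / β| < κ / β / 2 := not_le.1 hlt
  have h2 : κ / β / 2 < D N ω := by linarith [(abs_lt.1 h1).1]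
  have h3 : √(M N) * (noisyTailEstimator N (δ N) r (fun i => a i ω + ρ N i ω) - β) =
      S N ω / max (D N ω) (κ / β / 2) := by
    have hD0 : 0 < D N ω := (half_pos hc).trans h2
    have hT0 : (∑ i ∈ Finset.range N, logExcess (δ N) r (a i ω + ρ N i ω)) ≠ 0 := by
      intro h0
      simp only [hD, h0, mul_zero, lt_irrefl] at hD0
    have hs := Real.sqrt_pos.2 hN0
    have hss := Real.mul_self_sqrt hN0.le
    rw [max_eq_left h2.le, noisyTailEstimator_eq_div (hδ_pos N)]
    simp only [hS, hD, jumpAffine, Finset.sum_add_distrib, ← Finset.mul_sum]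
    rw [div_sub' hT0, ← mul_div_assoc, div_eq_div_iff hT0 (mul_ne_zero (inv_ne_zero hN0.ne') hT0)]
    nth_rewrite 2 [← hss]
    field_simp
    ring
  have hω' : ε ≤ ‖√(M N) * (noisyTailEstimator N (δ N) r (fun i => a i ω + ρ N i ω) - β) -
      S N ω / max (D N ω) (κ / β / 2) - 0‖ := hω
  rw [h3, sub_self, sub_zero, norm_zero] at hω'
  exact absurd hω' (not_le.2 hε)
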